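/- Let $q,t\in\mathbb{C}^*$ with $0<|q|<1$, and let $s\ge 1$, $n\ge 0$ be integers. Put $(u)_\infty=\prod_{l\ge 0}(1-uq^l)$, $\theta(u)=(u)_\infty(q/u)_\infty$ and $e(a;b)=a^{-1}\theta(ab)\theta(ab^{-1})$ for $a,b,u\in\mathbb{C}^*$. For $m\ge 0$ let $H_{m,n}$ be the complex vector space of all holomorphic functions $f$ on $(\mathbb{C}^*)^n$ that are invariant under all permutations and inversions $z_i\mapsto z_i^{-1}$ of the coordinates and satisfy $f(z_1,\dots,qz_i,\dots,z_n)=(qz_i^2)^{-m}f(z)$ for $i=1,\dots,n$. Let $Z=\{\mu\in\mathbb{Z}_{\ge0}^s : \mu_1+\cdots+\mu_s=n\}$, and for $x\in(\mathbb{C}^*)^s$ and $\mu\in Z$ put $$x_\mu=(x_1,x_1t,\dots,x_1t^{\mu_1-1},\;\dots,\;x_s,x_st,\dots,x_st^{\mu_s-1})\in(\mathbb{C}^*)^n .$$ Let $x\in(\mathbb{C}^*)^s$ be generic in the sense that $e(x_it^a;x_jt^b)\ne 0$ for all $1\le i<j\le s$ and all integers $a,b\ge 0$ with $a+b\le n-1$.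 Then there is a unique basis $(E_\mu(x;\cdot))_{\mu\in Z}$ of $H_{s-1,n}$ with $E_\lambda(x;x_\mu)=\delta_{\lambda\mu}$ for all $\lambda,\mu\in Z$ (the elliptic Lagrange interpolation functions of type $BC_n$). For every $y\in(\mathbb{C}^*)^s$, the determinant of the transition matrix $E(x;y)=\big(E_\mu(x;y_\nu)\big)_{\mu,\nu\in Z}$ is $$\det E(x;y)=\prod_{k=1}^n\bigg[\prod_{r=0}^{n-k}\prod_{1\le i<j\le s}\frac{e(y_it^r;y_jt^{(n-k)-r})}{e(x_it^r;x_jt^{(n-k)-r})}\bigg]^{\binom{s+k-3}{k-1}},$$ or equivalently $$\det E(x;y)=\prod_{k=1}^n\bigg[\prod_{r=0}^{n-k}\prod_{1\le i<j\le s}\frac{x_i\,\theta(t^{2r-(n-k)}y_iy_j^{-1})\,\theta(t^{n-k}y_iy_j)}{y_i\,\theta(t^{2r-(n-k)}x_ix_j^{-1})\,\theta(t^{n-k}x_ix_j)}\bigg]^{\binom{s+k-3}{k-1}}$$ (for $s=1$ the products over $i<j$ are empty and the determinant is $1$). -/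

import Mathlib

/-- The infinite `q`-shifted factorial `(u)_∞ = ∏_{l ≥ 0} (1 - u q^l)`
(an absolutely convergent product, since `|q| < 1` in all uses). -/
noncomputable def qShiftedFactorial (q : ℂˣ) (u : ℂ) : ℂ :=
  ∏' l : ℕ, (1 - u * (q : ℂ) ^ l)

/-- The theta function `θ(u) = (u)_∞ (q/u)_∞` on `ℂ^*`. -/
noncomputable def theta (q u : ℂˣ) : ℂ :=
  qShiftedFactorial q (u : ℂ) * qShiftedFactorial q ((q / u : ℂˣ) : ℂ)

/-- The symbol `e(a; b) = a⁻¹ θ(a b) θ(a b⁻¹)`. -/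
noncomputable def eSymbol (q a b : ℂˣ) : ℂ :=
  (a : ℂ)⁻¹ * theta q (a * b) * theta q (a * b⁻¹)

/-- A function on the torus `(ℂ^*)^n` is holomorphic if it is the restriction of a function of
`n` complex variables that is complex differentiable at the points with nonzero coordinates. -/
def HolomorphicOnTorus {n : ℕ} (f : (Fin n → ℂˣ) → ℂ) : Prop :=
  ∃ F : (Fin n → ℂ) → ℂ,
    DifferentiableOn ℂ F {z | ∀ i, z i ≠ 0} ∧ ∀ z : Fin n → ℂˣ, f z = F (fun i => (z i : ℂ))

/-- Invariance under the hyperoctahedral group `{±1}^n ⋊ 𝔖_n`, which acts by permutations and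
inversions of the coordinates. -/
def IsWeylInvariant {n : ℕ} (f : (Fin n → ℂˣ) → ℂ) : Prop :=
  (∀ (σ : Equiv.Perm (Fin n)) (z : Fin n → ℂˣ), f (fun i => z (σ i)) = f z) ∧
    ∀ (i : Fin n) (z : Fin n → ℂˣ), f (Function.update z i (z i)⁻¹) = f z

/-- The space `H_{m,n}` of holomorphic functions on `(ℂ^*)^n`, invariant under the
hyperoctahedral group, such that `f(…, q z_i, …) = (q z_i²)^{-m} f(z)` for every `i`. -/
def thetaSpace (q : ℂˣ) (m n : ℕ) : Submodule ℂ ((Fin n → ℂˣ) → ℂ) where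
  carrier := {f | HolomorphicOnTorus f ∧ IsWeylInvariant f ∧
    ∀ (i : Fin n) (z : Fin n → ℂˣ),
      f (Function.update z i (q * z i)) = (((q : ℂ) * (z i : ℂ) ^ 2) ^ m)⁻¹ * f z}
  zero_mem' :=
    ⟨⟨fun _ => 0, differentiableOn_const _, fun _ => rfl⟩, ⟨fun _ _ => rfl, fun _ _ => rfl⟩,
      fun _ _ => by simp⟩
  add_mem' := by
    rintro f g ⟨⟨F, hF, hfF⟩, ⟨hf1, hf2⟩, hf3⟩ ⟨⟨G, hG, hgG⟩, ⟨hg1, hg2⟩, hg3⟩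
    refine ⟨⟨fun z => F z + G z, hF.add hG, fun z => ?_⟩, ⟨fun σ z => ?_, fun i z => ?_⟩,
      fun i z => ?_⟩
    · simp only [Pi.add_apply, hfF, hgG]
    · simp only [Pi.add_apply, hf1, hg1]
    · simp only [Pi.add_apply, hf2, hg2]
    · simp only [Pi.add_apply, hf3, hg3, mul_add]
  smul_mem' := by
    rintro c f ⟨⟨F, hF, hfF⟩, ⟨hf1, hf2⟩, hf3⟩
    refine ⟨⟨fun z => c * F z, hF.const_mul c, fun z => ?_⟩, ⟨fun σ z => ?_, fun i z => ?_⟩,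
      fun i z => ?_⟩
    · simp only [Pi.smul_apply, smul_eq_mul, hfF]
    · simp only [Pi.smul_apply, smul_eq_mul, hf1]
    · simp only [Pi.smul_apply, smul_eq_mul, hf2]
    · simp only [Pi.smul_apply, smul_eq_mul, hf3, mul_left_comm]

/-- The index set `Z_{s,n}` of all `μ ∈ ℕ^s` with `μ_1 + ⋯ + μ_s = n`. -/
abbrev MultiIndex (s n : ℕ) : Type := {μ : Fin s → ℕ // ∑ i, μ i = n}

instance (s n : ℕ) : Fintype (MultiIndex s n) :=
  Fintype.subtype (Finset.piAntidiag Finset.univ n) (by simp)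

/-- The point `x_μ = (x_1, x_1 t, …, x_1 t^{μ_1-1}, …, x_s, x_s t, …, x_s t^{μ_s-1})` of
`(ℂ^*)^n`; `finSigmaFinEquiv` is the lexicographic enumeration of the pairs `(i, a)` with
`a < μ_i`. -/
def nodePoint (t : ℂˣ) {s n : ℕ} (x : Fin s → ℂˣ) (μ : MultiIndex s n) : Fin n → ℂˣ :=
  fun k =>
    let p := finSigmaFinEquiv.symm (Fin.cast μ.2.symm k)
    x p.1 * t ^ (p.2 : ℕ)

/-- The genericity condition on `x ∈ (ℂ^*)^s`: the numbers `e(x_i t^a; x_j t^b)` with `i < j` and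
`a + b ≤ n - 1` do not vanish. -/
def IsGenericNode (q t : ℂˣ) (n : ℕ) {s : ℕ} (x : Fin s → ℂˣ) : Prop :=
  ∀ i j : Fin s, i < j → ∀ a b : ℕ, a + b < n → eSymbol q (x i * t ^ a) (x j * t ^ b) ≠ 0

/-- `E` is a basis of `H_{s-1,n}` with the interpolation property `E_λ(x_μ) = δ_{λμ}`; its member
`E_λ` is the elliptic Lagrange interpolation function `E_λ(x; ·)`. -/
def IsLagrangeBasis (q t : ℂˣ) {s n : ℕ} (x : Fin s → ℂˣ)
    (E : Module.Basis (MultiIndex s n) ℂ (thetaSpace q (s - 1) n)) : Prop :=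
  ∀ l μ : MultiIndex s n,
    (E l : (Fin n → ℂˣ) → ℂ) (nodePoint t x μ) = if l = μ then 1 else 0

/-- The transition matrix `(E_μ(y_ν))_{μ,ν}`. -/
noncomputable def transitionMatrix (q t : ℂˣ) {s n : ℕ}
    (E : Module.Basis (MultiIndex s n) ℂ (thetaSpace q (s - 1) n)) (y : Fin s → ℂˣ) :
    Matrix (MultiIndex s n) (MultiIndex s n) ℂ :=
  Matrix.of fun μ ν => (E μ : (Fin n → ℂˣ) → ℂ) (nodePoint t y ν)

/-! The interpolation functions are sums over lattice paths in `ℕ^s`. Let `T_z` be the operator `φ ↦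
(l ↦ ∑_i L_i(x t^l; z) φ(l + ε_i))` (`interpStep`), where the `L_i` are the one-variable Lagrange
functions at the nodes `x_i t^{l_i}`, and put `E_μ(z) = (T_{z_1} ⋯ T_{z_n} δ_μ)(0)` (`lagrangeFun`).
The three-term relation for `e` makes these operators commute at the relevant `l`
(`interpStep_comm`), so `E_μ` is symmetric; its holomorphy, inversion invariance and
quasi-periodicity come from the `L_i`. At `z = x_i t^{l_i}` only the step in direction `i` survives.
Hence ordering the coordinates of `x_ν` along a path from `0` to `ν` gives `E_μ(x_ν) = δ_{μν}`, and
evaluation at the points `x_ν` is onto.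

The dimension bound comes from another evaluation, the one with `t = 1`: it is injective by
one-variable interpolation in each coordinate (`nodeEval_one_injective`). So evaluation at the `x_ν`
is bijective, which gives existence and uniqueness of the basis.

For the determinant, first replace a single coordinate `x_p` by `w`. The unchanged coordinates force
the initial part of each path, so the transition matrix is triangular with respect to `μ_p`, and its
diagonal entries are products over paths in direction `p` alone (`det_lagrangeFun_update`). The
factor `e(w t^a; x_j t^b)` occurs once for each `ν` with `ν_p > a` and `ν_j = b`; counting these `ν`
gives the binomial exponent (`card_multiIndex_filter`). Transition matrices multiply under change of
basis, so the coordinates of `x` can be exchanged for those of `y` one at a time as long as every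
intermediate point is generic. A perturbation of `y` and continuity remove this restriction
(`det_transitionMatrix`). -/

/-! ### The theta function: holomorphy, functional equations, zeros -/

theorem summable_mul_pow {q : ℂ} (hq : ‖q‖ < 1) (u : ℂ) : Summable fun l : ℕ => ‖-(u * q ^ l)‖ := by
  simpa [norm_mul, norm_pow] using (summable_geometric_of_lt_one (norm_nonneg q) hq).mul_left ‖u‖

theorem multipliable_qShiftedFactorial {q : ℂ} (hq : ‖q‖ < 1) (u : ℂ) :
    Multipliable fun l : ℕ => 1 - u * q ^ l := by
  simpa [sub_eq_add_neg] using multipliable_one_add_of_summable (summable_mul_pow hq u)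

theorem qShiftedFactorial_eq_mul {q : ℂˣ} (hq : ‖(q : ℂ)‖ < 1) (u : ℂ) :
    qShiftedFactorial q u = (1 - u) * qShiftedFactorial q (q * u) := by
  unfold qShiftedFactorial
  have h : ∀ l : ℕ, 1 - (q : ℂ) * u * (q : ℂ) ^ l = 1 - u * (q : ℂ) ^ (l + 1) := fun l => by ring
  rw [tprod_eq_zero_mul']
  · simp [h]
  · simpa [h] using multipliable_qShiftedFactorial hq (q * u)

theorem qShiftedFactorial_eq_zero {q : ℂˣ} (hq : ‖(q : ℂ)‖ < 1) {u : ℂ}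
    (h : qShiftedFactorial q u = 0) : ∃ l : ℕ, u * (q : ℂ) ^ l = 1 := by
  by_contra! hne
  refine tprod_one_add_ne_zero_of_summable (f := fun l : ℕ => -(u * (q : ℂ) ^ l)) ?_
    (summable_mul_pow hq u) (by simpa [qShiftedFactorial, sub_eq_add_neg] using h)
  intro l hl
  exact hne l (by linear_combination -hl)

theorem differentiable_qShiftedFactorial {q : ℂˣ} (hq : ‖(q : ℂ)‖ < 1) :
    Differentiable ℂ (qShiftedFactorial q) := by
  intro u₀
  have hB : IsOpen (Metric.ball (0 : ℂ) (‖u₀‖ + 1)) := Metric.isOpen_ball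
  have hs : Summable fun l : ℕ => (‖u₀‖ + 1) * ‖(q : ℂ)‖ ^ l :=
    (summable_geometric_of_lt_one (norm_nonneg _) hq).mul_left _
  have h := Summable.hasProdLocallyUniformlyOn_nat_one_add (f := fun (l : ℕ) (u : ℂ) => -(u * (q : ℂ) ^ l))
    hB hs (.of_forall fun l u hu => ?_) (fun l => by fun_prop)
  · have hd := h.differentiableOn (.of_forall fun _ => by
      simpa [Finset.prod_fn] using DifferentiableOn.finsetProd (fun _ _ => by fun_prop)) hB
    have := hd.differentiableAt (hB.mem_nhds (x := u₀) (by simp))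
    have e : qShiftedFactorial q = fun u => ∏' l : ℕ, (1 + -(u * (q : ℂ) ^ l)) := by
      funext u
      simp [qShiftedFactorial, sub_eq_add_neg]
    rw [e]
    exact this
  · simp only [norm_neg, norm_mul, norm_pow]
    have : ‖u‖ < ‖u₀‖ + 1 := by simpa using hu
    gcongr

/-- The theta function as a function of a complex variable. -/
noncomputable def thetaFun (q : ℂˣ) (u : ℂ) : ℂ :=
  qShiftedFactorial q u * qShiftedFactorial q (q / u)

theorem theta_eq_thetaFun (q u : ℂˣ) : theta q u = thetaFun q u := by
  simp [theta, thetaFun]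

theorem differentiableAt_thetaFun {q : ℂˣ} (hq : ‖(q : ℂ)‖ < 1) {u : ℂ} (hu : u ≠ 0) :
    DifferentiableAt ℂ (thetaFun q) u := by
  have h := differentiable_qShiftedFactorial hq
  have h2 : DifferentiableAt ℂ (fun u : ℂ => qShiftedFactorial q (q / u)) u :=
    DifferentiableAt.fun_comp' u (h _) (by fun_prop (disch := assumption))
  exact (h u).mul h2

theorem thetaFun_q_mul {q : ℂˣ} (hq : ‖(q : ℂ)‖ < 1) {u : ℂ} (hu : u ≠ 0) :
    thetaFun q (q * u) = -u⁻¹ * thetaFun q u := by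
  have hq0 : (q : ℂ) ≠ 0 := q.ne_zero
  have h1 := qShiftedFactorial_eq_mul hq u
  have h2 := qShiftedFactorial_eq_mul hq u⁻¹
  have h3 : (q : ℂ) / (q * u) = u⁻¹ := by field_simp
  have h4 : (q : ℂ) / u = q * u⁻¹ := by field_simp
  unfold thetaFun
  rw [h3, h4, h1, h2]
  field_simp
  ring

theorem thetaFun_inv {q : ℂˣ} (hq : ‖(q : ℂ)‖ < 1) {u : ℂ} (hu : u ≠ 0) :
    thetaFun q u⁻¹ = -u⁻¹ * thetaFun q u := by
  have hq0 : (q : ℂ) ≠ 0 := q.ne_zero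
  rw [← thetaFun_q_mul hq hu]
  unfold thetaFun
  rw [mul_comm]
  congr 2 <;> field_simp

theorem thetaFun_one {q : ℂˣ} (hq : ‖(q : ℂ)‖ < 1) : thetaFun q 1 = 0 := by
  simp [thetaFun, qShiftedFactorial_eq_mul hq 1]

theorem thetaFun_eq_zero {q : ℂˣ} (hq : ‖(q : ℂ)‖ < 1) {u : ℂ} (hu : u ≠ 0)
    (h : thetaFun q u = 0) : ∃ l : ℤ, u = (q : ℂ) ^ l := by
  have hq0 : (q : ℂ) ≠ 0 := q.ne_zero
  rcases mul_eq_zero.mp h with h | h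
  · obtain ⟨l, hl⟩ := qShiftedFactorial_eq_zero hq h
    exact ⟨-l, by rw [zpow_neg, zpow_natCast]; exact eq_inv_of_mul_eq_one_left hl⟩
  · obtain ⟨l, hl⟩ := qShiftedFactorial_eq_zero hq h
    refine ⟨l + 1, ?_⟩
    rw [zpow_add₀ hq0, zpow_natCast, zpow_one]
    field_simp at hl
    linear_combination -hl

/-! ### The symbol `e` in a complex variable -/

/-- The symbol `e(z; b)` as a function of a complex variable `z`. -/
noncomputable def eFun (q : ℂˣ) (z : ℂ) (b : ℂˣ) : ℂ :=
  z⁻¹ * thetaFun q (z * b) * thetaFun q (z * (b : ℂ)⁻¹)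

theorem eSymbol_eq_eFun (q a b : ℂˣ) : eSymbol q a b = eFun q a b := by
  simp [eSymbol, eFun, theta_eq_thetaFun]

theorem differentiableAt_eFun {q : ℂˣ} (hq : ‖(q : ℂ)‖ < 1) (b : ℂˣ) {z : ℂ} (hz : z ≠ 0) :
    DifferentiableAt ℂ (fun z => eFun q z b) z := by
  have hb := b.ne_zero
  have h1 : DifferentiableAt ℂ (fun z : ℂ => thetaFun q (z * b)) z :=
    DifferentiableAt.fun_comp' z (differentiableAt_thetaFun hq (by positivity)) (by fun_prop)
  have h2 : DifferentiableAt ℂ (fun z : ℂ => thetaFun q (z * (b : ℂ)⁻¹)) z :=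
    DifferentiableAt.fun_comp' z (differentiableAt_thetaFun hq (by positivity)) (by fun_prop)
  unfold eFun
  fun_prop (disch := assumption)

theorem eFun_inv {q : ℂˣ} (hq : ‖(q : ℂ)‖ < 1) (b : ℂˣ) {z : ℂ} (hz : z ≠ 0) :
    eFun q z⁻¹ b = eFun q z b := by
  have hb := b.ne_zero
  have h1 := thetaFun_inv hq (u := z * (b : ℂ)) (by positivity)
  have h2 := thetaFun_inv hq (u := z * (b : ℂ)⁻¹) (by positivity)
  have e1 : z⁻¹ * (b : ℂ) = (z * (b : ℂ)⁻¹)⁻¹ := by field_simp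
  have e2 : z⁻¹ * (b : ℂ)⁻¹ = (z * (b : ℂ))⁻¹ := by field_simp
  unfold eFun
  rw [e1, e2, h1, h2]
  field_simp

theorem eFun_q_mul {q : ℂˣ} (hq : ‖(q : ℂ)‖ < 1) (b : ℂˣ) {z : ℂ} (hz : z ≠ 0) :
    eFun q (q * z) b = (q * z ^ 2)⁻¹ * eFun q z b := by
  have hb := b.ne_zero
  have hq0 : (q : ℂ) ≠ 0 := q.ne_zero
  have h1 := thetaFun_q_mul hq (u := z * (b : ℂ)) (by positivity)
  have h2 := thetaFun_q_mul hq (u := z * (b : ℂ)⁻¹) (by positivity)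
  unfold eFun
  rw [mul_assoc (q : ℂ), mul_assoc (q : ℂ), h1, h2]
  field_simp

theorem eFun_self {q : ℂˣ} (hq : ‖(q : ℂ)‖ < 1) (b : ℂˣ) : eFun q b b = 0 := by
  simp [eFun, thetaFun_one hq]

theorem eFun_antisymm {q : ℂˣ} (hq : ‖(q : ℂ)‖ < 1) (a b : ℂˣ) :
    eFun q a b = -eFun q b a := by
  have ha := a.ne_zero
  have hb := b.ne_zero
  have h1 := thetaFun_inv hq (u := (b : ℂ) * (a : ℂ)⁻¹) (by positivity)
  have e1 : (a : ℂ) * (b : ℂ)⁻¹ = ((b : ℂ) * (a : ℂ)⁻¹)⁻¹ := by field_simp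
  unfold eFun
  rw [e1, h1, mul_comm (b : ℂ) (a : ℂ)]
  field_simp

theorem eFun_eq_zero {q : ℂˣ} (hq : ‖(q : ℂ)‖ < 1) (a b : ℂˣ) (h : eFun q a b = 0) :
    ∃ l : ℤ, (a : ℂ) * b = (q : ℂ) ^ l ∨ (a : ℂ) * (b : ℂ)⁻¹ = (q : ℂ) ^ l := by
  have ha := a.ne_zero
  have hb := b.ne_zero
  rcases mul_eq_zero.mp h with h | h
  · rcases mul_eq_zero.mp h with h | h
    · simp at h
    · obtain ⟨l, hl⟩ := thetaFun_eq_zero hq (by positivity) h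
      exact ⟨l, .inl hl⟩
  · obtain ⟨l, hl⟩ := thetaFun_eq_zero hq (by positivity) h
    exact ⟨l, .inr hl⟩

/-! ### Laurent coefficients on the punctured plane -/

/-- Up to the factor `2π`, the `k`-th Laurent coefficient of a function holomorphic on `ℂ^*`. -/
noncomputable def laurentCoeff (G : ℂ → ℂ) (k : ℤ) : ℂ :=
  ∫ θ in (0 : ℝ)..2 * Real.pi, G (circleMap 0 1 θ) * circleMap 0 1 θ ^ (-k)

theorem circleMap_zero_one_ne_zero (θ : ℝ) : circleMap 0 1 θ ≠ 0 :=
  circleMap_ne_center one_ne_zero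

/-- Cauchy's theorem on an annulus, applied to `H(z)/z`: the parametrization turns `dz/z` into `i
dθ`. -/
theorem integral_circleMap_eq_of_le {H : ℂ → ℂ} (hH : DifferentiableOn ℂ H {0}ᶜ) {r R : ℝ}
    (hr : 0 < r) (hR : r ≤ R) :
    ∫ θ in (0 : ℝ)..2 * Real.pi, H (circleMap 0 R θ) =
      ∫ θ in (0 : ℝ)..2 * Real.pi, H (circleMap 0 r θ) := by
  have h0 : ∀ z ∈ Metric.closedBall (0 : ℂ) R \ Metric.ball 0 r, z ∈ ({0}ᶜ : Set ℂ) := by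
    intro z hz hz0
    simp only [Set.mem_singleton_iff] at hz0
    subst hz0
    exact hz.2 (by simpa using hr)
  have hd : DifferentiableOn ℂ (fun z => z⁻¹ * H z) {0}ᶜ :=
    (differentiableOn_inv.mono (by intro z hz; simpa using hz)).mul hH
  have h := Complex.circleIntegral_eq_of_differentiable_on_annulus_off_countable (c := 0) hr hR
    (f := fun z => z⁻¹ * H z) Set.countable_empty (hd.continuousOn.mono h0) (fun z hz => by
      refine hd.differentiableAt (isOpen_compl_singleton.mem_nhds (h0 z ?_))
      exact ⟨Metric.ball_subset_closedBall hz.1.1, fun h => hz.1.2 (Metric.ball_subset_closedBall h)⟩)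
  have key : ∀ ρ : ℝ, 0 < ρ → (∮ z in C(0, ρ), z⁻¹ * H z) =
      Complex.I * ∫ θ in (0 : ℝ)..2 * Real.pi, H (circleMap 0 ρ θ) := by
    intro ρ hρ
    rw [circleIntegral, ← intervalIntegral.integral_const_mul]
    congr 1
    funext θ
    have := circleMap_ne_center (c := 0) hρ.ne' (θ := θ)
    simp only [deriv_circleMap, smul_eq_mul]
    field_simp
  rw [key r hr, key R (hr.trans_le hR)] at h
  exact mul_left_cancel₀ Complex.I_ne_zero h

theorem integral_circleMap_eq {H : ℂ → ℂ} (hH : DifferentiableOn ℂ H {0}ᶜ) {r : ℝ} (hr : 0 < r) :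
    ∫ θ in (0 : ℝ)..2 * Real.pi, H (circleMap 0 r θ) =
      ∫ θ in (0 : ℝ)..2 * Real.pi, H (circleMap 0 1 θ) := by
  rcases le_total r 1 with h | h
  · exact (integral_circleMap_eq_of_le hH hr h).symm
  · exact integral_circleMap_eq_of_le hH one_pos h

theorem mul_circleMap_zero_one (c : ℂ) (θ : ℝ) :
    c * circleMap 0 1 θ = circleMap 0 ‖c‖ (θ + c.arg) := by
  have h := Complex.norm_mul_exp_arg_mul_I c
  simp only [circleMap, zero_add, Complex.ofReal_one, one_mul, Complex.ofReal_add]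
  rw [add_mul, Complex.exp_add]
  linear_combination (-Complex.exp (θ * Complex.I)) * h

/-- Multiplication by `c` changes the radius, which is harmless by Cauchy, and rotates by `arg c`,
which is harmless by periodicity. With `c = q` this turns quasi-periodicity into a recurrence for
Laurent coefficients. -/
theorem integral_mul_circleMap_eq {H : ℂ → ℂ} (hH : DifferentiableOn ℂ H {0}ᶜ) {c : ℂ}
    (hc : c ≠ 0) :
    ∫ θ in (0 : ℝ)..2 * Real.pi, H (c * circleMap 0 1 θ) =
      ∫ θ in (0 : ℝ)..2 * Real.pi, H (circleMap 0 1 θ) := by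
  have hp : Function.Periodic (fun θ => H (circleMap 0 ‖c‖ θ)) (2 * Real.pi) := fun θ => by
    simp only [periodic_circleMap 0 ‖c‖ θ]
  simp only [mul_circleMap_zero_one]
  rw [← integral_circleMap_eq hH (norm_pos_iff.mpr hc),
    intervalIntegral.integral_comp_add_right (fun θ => H (circleMap 0 ‖c‖ θ)), zero_add, add_comm]
  simpa using hp.intervalIntegral_add_eq c.arg 0

theorem differentiableOn_mul_zpow {G : ℂ → ℂ} (hG : DifferentiableOn ℂ G {0}ᶜ) (k : ℤ) :
    DifferentiableOn ℂ (fun z => G z * z ^ k) {0}ᶜ :=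
  hG.mul fun _ hz => (differentiableAt_zpow.mpr (.inl hz)).differentiableWithinAt

theorem continuous_comp_mul_circleMap {G : ℂ → ℂ} (hG : DifferentiableOn ℂ G {0}ᶜ) {c : ℂ}
    (hc : c ≠ 0) : Continuous fun θ : ℝ => G (c * circleMap 0 1 θ) :=
  hG.continuousOn.comp_continuous (by fun_prop) fun θ =>
    mul_ne_zero hc (circleMap_zero_one_ne_zero θ)

/-- A function holomorphic on `ℂ^*` all of whose Laurent coefficients vanish is zero. -/
theorem eq_zero_of_laurentCoeff {G : ℂ → ℂ} (hG : DifferentiableOn ℂ G {0}ᶜ)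
    (h : ∀ k, laurentCoeff G k = 0) {c : ℂ} (hc : c ≠ 0) : G c = 0 := by
  have : Fact (0 < 2 * Real.pi) := ⟨Real.two_pi_pos⟩
  have hp : Function.Periodic (fun θ => G (c * circleMap 0 1 θ)) (2 * Real.pi) := fun θ => by
    simp only [periodic_circleMap 0 1 θ]
  let f : C(AddCircle (2 * Real.pi), ℂ) :=
    ⟨hp.lift, continuous_coinduced_dom.mpr (continuous_comp_mul_circleMap hG hc)⟩
  have hf : ∀ θ : ℝ, f (θ : AddCircle (2 * Real.pi)) = G (c * circleMap 0 1 θ) := fun θ => rfl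
  -- On the circle through `c`, the Fourier coefficients are the Laurent coefficients times `c ^ k`,
  -- up to a constant. They all vanish, so the Fourier series is trivially summable and converges
  -- pointwise to `f`; the point `c` is at angle `0`.
  have hcoeff : ∀ k : ℤ, fourierCoeff f k = 0 := by
    intro k
    rw [fourierCoeff_eq_intervalIntegral f k 0]
    have e : ∀ θ : ℝ, @fourier (2 * Real.pi) (-k) θ • f θ =
        c ^ k * (G (c * circleMap 0 1 θ) * (c * circleMap 0 1 θ) ^ (-k)) := by
      intro θ
      have h1 : @fourier (2 * Real.pi) (-k) θ = circleMap 0 1 θ ^ (-k) := by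
        rw [fourier_coe_apply, circleMap_zero, Complex.ofReal_one, one_mul, ← Complex.exp_int_mul]
        congr 1
        have := Real.pi_ne_zero
        push_cast
        field_simp
      rw [h1, hf, mul_zpow, smul_eq_mul]
      have := zpow_neg_mul_zpow_self k hc
      linear_combination (-circleMap 0 1 θ ^ (-k) * G (c * circleMap 0 1 θ)) * this
    simp only [e]
    rw [intervalIntegral.integral_const_mul, zero_add,
      integral_mul_circleMap_eq (differentiableOn_mul_zpow hG (-k)) hc]
    have := h k
    rw [laurentCoeff] at this
    rw [this]
    simp
  have hs := has_pointwise_sum_fourier_series_of_summable (f := f)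
    (by simp [funext hcoeff]) ((0 : ℝ) : AddCircle (2 * Real.pi))
  simp only [hcoeff, zero_smul] at hs
  have := hs.unique hasSum_zero
  rw [hf] at this
  simpa [circleMap] using this

/-! ### One-variable theta functions and interpolation -/

/-- The space of functions of one variable, holomorphic on `ℂ^*`, invariant under inversion and
multiplied by `(q z²)^{-m}` under `z ↦ q z`. -/
def lineThetaSpace (q : ℂˣ) (m : ℕ) : Submodule ℂ (ℂ → ℂ) where
  carrier := {G | DifferentiableOn ℂ G {0}ᶜ ∧ (∀ z, z ≠ 0 → G z⁻¹ = G z) ∧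
    ∀ z, z ≠ 0 → G (q * z) = ((q * z ^ 2) ^ m)⁻¹ * G z}
  zero_mem' := ⟨differentiableOn_const _, fun _ _ => rfl, fun _ _ => by simp⟩
  add_mem' := by
    rintro f g ⟨hf1, hf2, hf3⟩ ⟨hg1, hg2, hg3⟩
    refine ⟨hf1.add hg1, fun z hz => ?_, fun z hz => ?_⟩
    · simp [hf2 z hz, hg2 z hz]
    · simp [hf3 z hz, hg3 z hz, mul_add]
  smul_mem' := by
    rintro c f ⟨hf1, hf2, hf3⟩
    refine ⟨hf1.const_smul c, fun z hz => ?_, fun z hz => ?_⟩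
    · simp [hf2 z hz]
    · simp [hf3 z hz, mul_left_comm]

theorem laurentCoeff_add_two_mul {q : ℂˣ} {m : ℕ} {G : ℂ → ℂ} (hG : G ∈ lineThetaSpace q m)
    (k : ℤ) : laurentCoeff G (k + 2 * m) = (q : ℂ) ^ (k + m) * laurentCoeff G k := by
  obtain ⟨h1, -, h3⟩ := hG
  have hq : (q : ℂ) ≠ 0 := q.ne_zero
  have h := integral_mul_circleMap_eq (differentiableOn_mul_zpow h1 (-k)) hq
  rw [laurentCoeff, laurentCoeff, ← h, ← intervalIntegral.integral_const_mul]
  congr 1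
  funext θ
  have hz := circleMap_zero_one_ne_zero θ
  rw [h3 _ hz, mul_zpow, mul_pow, neg_add, zpow_add₀ hz, zpow_add₀ hq, zpow_neg, zpow_neg,
    zpow_neg, zpow_mul, zpow_natCast, zpow_natCast, zpow_ofNat]
  field_simp

theorem laurentCoeff_neg {q : ℂˣ} {m : ℕ} {G : ℂ → ℂ} (hG : G ∈ lineThetaSpace q m) (k : ℤ) :
    laurentCoeff G (-k) = laurentCoeff G k := by
  obtain ⟨-, h2, -⟩ := hG
  have hp : Function.Periodic (fun θ => G (circleMap 0 1 θ) * circleMap 0 1 θ ^ (-k))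
      (2 * Real.pi) := fun θ => by simp only [periodic_circleMap 0 1 θ]
  have e : ∀ θ : ℝ, circleMap 0 1 (-θ) = (circleMap 0 1 θ)⁻¹ := fun θ => by
    simp [circleMap, Complex.exp_neg]
  have h := intervalIntegral.integral_comp_neg (a := 0) (b := 2 * Real.pi)
    (fun θ => G (circleMap 0 1 θ) * circleMap 0 1 θ ^ (-k))
  have h' := hp.intervalIntegral_add_eq (-(2 * Real.pi)) 0
  rw [neg_add_cancel, zero_add] at h'
  rw [neg_zero, h'] at h
  rw [laurentCoeff, laurentCoeff, ← h]
  congr 1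
  funext θ
  rw [e, h2 _ (circleMap_zero_one_ne_zero θ), inv_zpow, zpow_neg, zpow_neg]

theorem zpow_ne_one_of_norm_lt_one {q : ℂ} (hq : ‖q‖ < 1) {k : ℤ} (hk : k ≠ 0) :
    q ^ k ≠ 1 := by
  intro h
  have h1 : ‖q‖ ^ k = 1 := by rw [← norm_zpow, h, norm_one]
  rcases zpow_eq_one_iff_of_ne_zero₀ hk |>.mp h1 with h2 | h2
  · exact hq.ne h2
  · linarith [norm_nonneg q, h2.1]

/-- An element of `lineThetaSpace q m` is determined by `m + 1` Laurent coefficients. -/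
theorem eq_zero_of_laurentCoeff_le {q : ℂˣ} (hq : ‖(q : ℂ)‖ < 1) {m : ℕ} {G : ℂ → ℂ}
    (hG : G ∈ lineThetaSpace q m) (h : ∀ k : ℕ, k ≤ m → laurentCoeff G k = 0) {c : ℂ}
    (hc : c ≠ 0) : G c = 0 := by
  have hq0 : (q : ℂ) ≠ 0 := q.ne_zero
  refine eq_zero_of_laurentCoeff hG.1 (fun k => ?_) hc
  have hsmall : ∀ k : ℤ, |k| ≤ m → laurentCoeff G k = 0 := by
    intro k hk
    rcases abs_cases k with ⟨h1, h2⟩ | ⟨h1, h2⟩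
    · lift k to ℕ using h2
      exact h k (by omega)
    · obtain ⟨j, hj⟩ := Int.eq_ofNat_of_zero_le (a := -k) (by omega)
      rw [← laurentCoeff_neg hG, hj]
      exact h j (by omega)
  -- For `m = 0` the recurrence has step `0` and reads `c_k = q^k c_k`. For `m > 0` it has step
  -- `2m`, and every residue class modulo `2m` has a representative of absolute value at most `m`,
  -- which the symmetry `c_{-k} = c_k` brings into `0, …, m`.
  rcases Nat.eq_zero_or_pos m with rfl | hm
  · by_cases hk : k = 0
    · subst hk
      exact hsmall 0 (by simp)
    · have := laurentCoeff_add_two_mul hG k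
      simp only [Nat.cast_zero, mul_zero, add_zero] at this
      have h2 : (1 - (q : ℂ) ^ k) * laurentCoeff G k = 0 := by linear_combination this
      exact (mul_eq_zero.mp h2).resolve_left
        (sub_ne_zero.mpr (zpow_ne_one_of_norm_lt_one hq hk).symm)
  · have hper : ∀ k : ℤ, laurentCoeff G (k + 2 * m) = 0 ↔ laurentCoeff G k = 0 := fun k => by
      rw [laurentCoeff_add_two_mul hG k, mul_eq_zero]
      simp [zpow_ne_zero _ hq0]
    have hiter : ∀ j k : ℤ, laurentCoeff G (k + 2 * m * j) = 0 ↔ laurentCoeff G k = 0 := by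
      intro j k
      induction j using Int.induction_on with
      | zero => simp
      | succ j ih =>
        rw [← ih, ← hper (k + 2 * m * j)]
        ring_nf
      | pred j ih =>
        rw [← ih, ← hper (k + 2 * m * (-j - 1))]
        ring_nf
    have hm' : (0 : ℤ) < 2 * m := by omega
    have h1 := Int.emod_nonneg k hm'.ne'
    have h2 := Int.emod_lt_of_pos k hm'
    rw [← Int.emod_add_mul_ediv k (2 * m), hiter]
    by_cases hle : k % (2 * m) ≤ m
    · exact hsmall _ (abs_le.mpr ⟨by omega, hle⟩)
    · rw [← hiter (-1)]
      exact hsmall _ (abs_le.mpr ⟨by omega, by omega⟩)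

theorem laurentCoeff_add {G H : ℂ → ℂ} (hG : DifferentiableOn ℂ G {0}ᶜ)
    (hH : DifferentiableOn ℂ H {0}ᶜ) (k : ℤ) :
    laurentCoeff (G + H) k = laurentCoeff G k + laurentCoeff H k := by
  have hc : ∀ {G : ℂ → ℂ}, DifferentiableOn ℂ G {0}ᶜ → Continuous fun θ : ℝ =>
      G (circleMap 0 1 θ) * circleMap 0 1 θ ^ (-k) := fun hG => by
    simpa using continuous_comp_mul_circleMap (differentiableOn_mul_zpow hG (-k)) one_ne_zero
  rw [laurentCoeff, laurentCoeff, laurentCoeff, ← intervalIntegral.integral_add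
    ((hc hG).intervalIntegrable _ _) ((hc hH).intervalIntegrable _ _)]
  simp [add_mul]

/-- The first `m + 1` Laurent coefficients as a linear map. -/
noncomputable def laurentCoeffMap (q : ℂˣ) (m : ℕ) :
    lineThetaSpace q m →ₗ[ℂ] (Fin (m + 1) → ℂ) where
  toFun G k := laurentCoeff G (k : ℕ)
  map_add' G H := funext fun k => laurentCoeff_add G.2.1 H.2.1 _
  map_smul' c G := funext fun k => by
    simp [laurentCoeff, mul_assoc, intervalIntegral.integral_const_mul]

theorem prod_eFun_mem_lineThetaSpace {q : ℂˣ} (hq : ‖(q : ℂ)‖ < 1) {ι : Type*} (S : Finset ι)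
    (x : ι → ℂˣ) : (fun z => ∏ j ∈ S, eFun q z (x j)) ∈ lineThetaSpace q S.card := by
  refine ⟨DifferentiableOn.fun_finsetProd fun j _ z hz =>
    (differentiableAt_eFun hq (x j) hz).differentiableWithinAt, fun z hz => ?_, fun z hz => ?_⟩
  · exact Finset.prod_congr rfl fun j _ => eFun_inv hq _ hz
  · simp only [eFun_q_mul hq _ hz, Finset.prod_mul_distrib, Finset.prod_const, inv_pow]

/-- One-variable interpolation: a theta function of degree `m` vanishing at `m + 1` points in
general position is zero. -/
theorem lineThetaSpace_eq_zero {q : ℂˣ} (hq : ‖(q : ℂ)‖ < 1) {m : ℕ} {G : ℂ → ℂ}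
    (hG : G ∈ lineThetaSpace q m) (x : Fin (m + 1) → ℂˣ)
    (hx : ∀ i j, i ≠ j → eFun q (x i) (x j) ≠ 0) (h : ∀ i, G (x i) = 0) {c : ℂ} (hc : c ≠ 0) :
    G c = 0 := by
  have hL : ∀ i : Fin (m + 1),
      (fun z => ∏ j ∈ Finset.univ.erase i, eFun q z (x j)) ∈ lineThetaSpace q m := fun i => by
    simpa using prod_eFun_mem_lineThetaSpace hq (Finset.univ.erase i) x
  -- `G` and the `m + 1` Lagrange products are `m + 2` elements whose coefficient vectors lie in an
  -- `(m + 1)`-dimensional space. Evaluating a dependence at the nodes kills the coefficients of the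
  -- products, so the one of `G` is nonzero.
  let v : Option (Fin (m + 1)) → lineThetaSpace q m := fun o => o.elim ⟨G, hG⟩ fun i => ⟨_, hL i⟩
  have hdep : ¬ LinearIndependent ℂ (laurentCoeffMap q m ∘ v) := by
    intro hli
    have := hli.fintype_card_le_finrank
    simp at this
  obtain ⟨g, hg, hne⟩ := Fintype.not_linearIndependent_iff.mp hdep
  have hker : laurentCoeffMap q m (∑ o, g o • v o) = 0 := by
    simpa [map_sum] using hg
  have hzero : ∀ z : ℂ, z ≠ 0 →
      g none * G z + ∑ i, g (some i) * ∏ j ∈ Finset.univ.erase i, eFun q z (x j) = 0 := by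
    intro z hz
    have := eq_zero_of_laurentCoeff_le hq (∑ o, g o • v o).2
      (fun k hk => congrFun hker ⟨k, by omega⟩) hz
    simpa [Fintype.sum_option, v] using this
  have hsome : ∀ i, g (some i) = 0 := by
    intro i
    have := hzero (x i) (x i).ne_zero
    rw [h, mul_zero, zero_add, Finset.sum_eq_single i] at this
    · refine (mul_eq_zero.mp this).resolve_right (Finset.prod_ne_zero_iff.mpr fun j hj => ?_)
      exact hx i j (Finset.ne_of_mem_erase hj).symm
    · intro j _ hj
      rw [Finset.prod_eq_zero (Finset.mem_erase.mpr ⟨hj.symm, Finset.mem_univ i⟩)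
        (eFun_self hq _), mul_zero]
    · simp
  have hnone : g none ≠ 0 := by
    obtain ⟨o, ho⟩ := hne
    cases o with
    | none => exact ho
    | some i => exact absurd (hsome i) ho
  have := hzero c hc
  simp only [hsome, zero_mul, Finset.sum_const_zero, add_zero] at this
  exact (mul_eq_zero.mp this).resolve_left hnone

theorem eFun_mem_lineThetaSpace {q : ℂˣ} (hq : ‖(q : ℂ)‖ < 1) (b : ℂˣ) :
    (fun z => eFun q z b) ∈ lineThetaSpace q 1 := by
  simpa using prod_eFun_mem_lineThetaSpace hq (Finset.univ : Finset (Fin 1)) fun _ => b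

/-- The three-term relation for `e`. -/
theorem eFun_three_term {q : ℂˣ} (hq : ‖(q : ℂ)‖ < 1) {a b : ℂˣ} (hab : eFun q a b ≠ 0) (c : ℂˣ)
    {w : ℂ} (hw : w ≠ 0) :
    eFun q w c * eFun q a b = eFun q w b * eFun q a c - eFun q w a * eFun q b c := by
  have hba := eFun_antisymm hq b a
  have hmem : eFun q a b • (fun z => eFun q z c) - (eFun q a c • (fun z => eFun q z b) -
      eFun q b c • (fun z => eFun q z a)) ∈ lineThetaSpace q 1 :=
    sub_mem (Submodule.smul_mem _ _ (eFun_mem_lineThetaSpace hq c))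
      (sub_mem (Submodule.smul_mem _ _ (eFun_mem_lineThetaSpace hq b))
        (Submodule.smul_mem _ _ (eFun_mem_lineThetaSpace hq a)))
  -- The difference of the two sides has degree `1` in `w` and vanishes at `w = a` and, by
  -- antisymmetry of `e`, at `w = b`.
  have h := lineThetaSpace_eq_zero hq hmem ![a, b] (fun i j hij => ?_) (fun i => ?_) hw
  · simp only [Pi.sub_apply, Pi.smul_apply, smul_eq_mul] at h
    linear_combination h
  · fin_cases i <;> fin_cases j <;> simp_all
  · fin_cases i <;> simp only [Pi.sub_apply, Pi.smul_apply, smul_eq_mul, Fin.zero_eta,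
      Fin.mk_one, Matrix.cons_val_zero, Matrix.cons_val_one, eFun_self hq, hba] <;> ring

/-- The two-direction case of commutation. It is used with `a`, `b` two current nodes and `c`, `d`
the same nodes multiplied by `t`. Expanding `e(·; c)` and `e(·; d)` in `e(·; a)` and `e(·; b)`
reduces it to an identity of rational functions. -/
theorem eFun_swap {q : ℂˣ} (hq : ‖(q : ℂ)‖ < 1) {a b c d : ℂˣ} (hab : eFun q a b ≠ 0)
    (hbc : eFun q b c ≠ 0) (had : eFun q a d ≠ 0) {z w : ℂ} (hz : z ≠ 0) (hw : w ≠ 0) :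
    eFun q z b / eFun q a b * (eFun q w c / eFun q b c) +
        eFun q z a / eFun q b a * (eFun q w d / eFun q a d) =
      eFun q w b / eFun q a b * (eFun q z c / eFun q b c) +
        eFun q w a / eFun q b a * (eFun q z d / eFun q a d) := by
  have h : ∀ (v : ℂ) (c : ℂˣ), v ≠ 0 →
      eFun q v c = (eFun q v b * eFun q a c - eFun q v a * eFun q b c) / eFun q a b :=
    fun v c hv => eq_div_of_mul_eq hab (eFun_three_term hq hab c hv)
  rw [h z c hz, h z d hz, h w c hw, h w d hw, eFun_antisymm hq b a]
  field_simp
  ring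

/-! ### Interpolation operators and their commutation -/

variable {s : ℕ}

/-- The elementary interpolation functions `∏_{j ≠ i} e(z; u_j) / e(u_i; u_j)`. -/
noncomputable def lagrangeFactor (q : ℂˣ) (u : Fin s → ℂˣ) (i : Fin s) (z : ℂ) : ℂ :=
  ∏ j ∈ Finset.univ.erase i, eFun q z (u j) / eFun q (u i) (u j)

/-- The shifted point `(x_i t^{l_i})_i`. -/
def shiftNode (t : ℂˣ) (x : Fin s → ℂˣ) (l : Fin s → ℕ) : Fin s → ℂˣ := fun i => x i * t ^ l i

/-- The operator `φ ↦ (l ↦ ∑_i L_i(x t^l; z) φ(l + ε_i))`, with `L_i` the elementary interpolation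
functions. -/
noncomputable def interpStep (q t : ℂˣ) (x : Fin s → ℂˣ) (z : ℂ) (φ : (Fin s → ℕ) → ℂ) :
    (Fin s → ℕ) → ℂ := fun l =>
  ∑ i, lagrangeFactor q (shiftNode t x l) i z * φ (l + Pi.single i 1)

/-- Composition of the operators `interpStep` along a list. -/
noncomputable def interpList (q t : ℂˣ) (x : Fin s → ℂˣ) (zs : List ℂ) (φ : (Fin s → ℕ) → ℂ) :
    (Fin s → ℕ) → ℂ := zs.foldr (interpStep q t x) φ

/-- The elliptic Lagrange interpolation functions. -/
noncomputable def lagrangeFun (q t : ℂˣ) (x : Fin s → ℂˣ) {n : ℕ} (μ : Fin s → ℕ)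
    (z : Fin n → ℂˣ) : ℂ :=
  interpList q t x (List.ofFn fun k => (z k : ℂ)) (Pi.single μ 1) 0

theorem interpList_cons (q t : ℂˣ) (x : Fin s → ℂˣ) (z : ℂ) (zs : List ℂ)
    (φ : (Fin s → ℕ) → ℂ) :
    interpList q t x (z :: zs) φ = interpStep q t x z (interpList q t x zs φ) := rfl

theorem interpList_append (q t : ℂˣ) (x : Fin s → ℂˣ) (zs ws : List ℂ) (φ : (Fin s → ℕ) → ℂ) :
    interpList q t x (zs ++ ws) φ = interpList q t x zs (interpList q t x ws φ) :=
  List.foldr_append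

theorem IsGenericNode.eFun_ne_zero {q t : ℂˣ} (hq : ‖(q : ℂ)‖ < 1) {n : ℕ} {x : Fin s → ℂˣ}
    (hx : IsGenericNode q t n x) {i j : Fin s} (hij : i ≠ j) {a b : ℕ} (hab : a + b < n) :
    eFun q ((x i * t ^ a : ℂˣ) : ℂ) (x j * t ^ b) ≠ 0 := by
  rcases lt_or_gt_of_ne hij with h | h
  · rw [← eSymbol_eq_eFun]
    exact hx i j h a b hab
  · rw [eFun_antisymm hq, neg_ne_zero, ← eSymbol_eq_eFun]
    exact hx j i h b a (by omega)

theorem add_le_sum_of_ne {l : Fin s → ℕ} {i j : Fin s} (hij : i ≠ j) : l i + l j ≤ ∑ k, l k := by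
  rw [← Finset.sum_pair hij]
  exact Finset.sum_le_sum_of_subset (Finset.subset_univ _)

theorem IsGenericNode.shiftNode_ne_zero {q t : ℂˣ} (hq : ‖(q : ℂ)‖ < 1) {n : ℕ} {x : Fin s → ℂˣ}
    (hx : IsGenericNode q t n x) {l : Fin s → ℕ} (hl : ∑ k, l k < n) {i j : Fin s}
    (hij : i ≠ j) : eFun q (shiftNode t x l i) (shiftNode t x l j) ≠ 0 :=
  hx.eFun_ne_zero hq hij ((add_le_sum_of_ne hij).trans_lt hl)

theorem shiftNode_add_single_of_ne (t : ℂˣ) (x : Fin s → ℂˣ) (l : Fin s → ℕ) {i j : Fin s}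
    (h : j ≠ i) : shiftNode t x (l + Pi.single i 1) j = shiftNode t x l j := by
  simp [shiftNode, h]

theorem sum_add_single (l : Fin s → ℕ) (i : Fin s) :
    ∑ k, (l + Pi.single i 1 : Fin s → ℕ) k = ∑ k, l k + 1 := by
  simp [Finset.sum_add_distrib]

theorem lagrangeFactor_mul_self (q t : ℂˣ) (x : Fin s → ℂˣ) (l : Fin s → ℕ) (i : Fin s)
    (z w : ℂ) :
    lagrangeFactor q (shiftNode t x l) i z *
        lagrangeFactor q (shiftNode t x (l + Pi.single i 1)) i w =
      lagrangeFactor q (shiftNode t x l) i w *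
        lagrangeFactor q (shiftNode t x (l + Pi.single i 1)) i z := by
  simp only [lagrangeFactor, ← Finset.prod_mul_distrib]
  refine Finset.prod_congr rfl fun j hj => ?_
  rw [shiftNode_add_single_of_ne t x l (Finset.ne_of_mem_erase hj)]
  ring

theorem lagrangeFactor_mul_of_ne (q t : ℂˣ) (x : Fin s → ℂˣ) (l : Fin s → ℕ) {i j : Fin s}
    (hij : i ≠ j) (z w : ℂ) :
    lagrangeFactor q (shiftNode t x l) i z *
        lagrangeFactor q (shiftNode t x (l + Pi.single i 1)) j w =
      eFun q z (shiftNode t x l j) / eFun q (shiftNode t x l i) (shiftNode t x l j) *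
        (eFun q w (shiftNode t x (l + Pi.single i 1) i) /
          eFun q (shiftNode t x l j) (shiftNode t x (l + Pi.single i 1) i)) *
        ∏ k ∈ (Finset.univ.erase i).erase j,
          (eFun q z (shiftNode t x l k) * eFun q w (shiftNode t x l k)) /
            (eFun q (shiftNode t x l i) (shiftNode t x l k) *
              eFun q (shiftNode t x l j) (shiftNode t x l k)) := by
  have hi : i ∈ Finset.univ.erase j := by simp [hij]
  have hj : j ∈ Finset.univ.erase i := by simp [hij.symm]
  rw [lagrangeFactor, lagrangeFactor, ← Finset.mul_prod_erase _ _ hj,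
    ← Finset.mul_prod_erase _ _ hi, Finset.erase_right_comm (a := j) (b := i)]
  rw [mul_mul_mul_comm, shiftNode_add_single_of_ne t x l hij.symm, ← Finset.prod_mul_distrib]
  congr 1
  refine Finset.prod_congr rfl fun k hk => ?_
  simp only [Finset.mem_erase] at hk
  rw [shiftNode_add_single_of_ne t x l hk.2.1]
  ring

theorem interpStep_comm {q t : ℂˣ} (hq : ‖(q : ℂ)‖ < 1) {n : ℕ} {x : Fin s → ℂˣ}
    (hx : IsGenericNode q t n x) {l : Fin s → ℕ} (hl : ∑ k, l k + 2 ≤ n) {z w : ℂ} (hz : z ≠ 0)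
    (hw : w ≠ 0) (φ : (Fin s → ℕ) → ℂ) :
    interpStep q t x z (interpStep q t x w φ) l = interpStep q t x w (interpStep q t x z φ) l := by
  let A : Fin s → Fin s → ℂ → ℂ → ℂ := fun i j z w => lagrangeFactor q (shiftNode t x l) i z *
    lagrangeFactor q (shiftNode t x (l + Pi.single i 1)) j w
  have hA : ∀ z w, interpStep q t x z (interpStep q t x w φ) l =
      ∑ i, ∑ j, A i j z w * φ (l + Pi.single i 1 + Pi.single j 1) := fun z w => by
    simp only [interpStep, Finset.mul_sum, A, mul_assoc]
  -- The paths `i, j` and `j, i` end at the same point, so only the sum of their weights has to be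
  -- symmetric in `z` and `w`.
  have hpair : ∀ i j, A i j z w + A j i z w = A i j w z + A j i w z := by
    intro i j
    rcases eq_or_ne i j with rfl | hij
    · simp only [A, lagrangeFactor_mul_self q t x l i z w]
    · simp only [A, lagrangeFactor_mul_of_ne q t x l hij, lagrangeFactor_mul_of_ne q t x l hij.symm]
      have hne : ∀ {i j : Fin s}, i ≠ j →
          eFun q (shiftNode t x l j) (shiftNode t x (l + Pi.single i 1) i) ≠ 0 := by
        intro i j hij
        have h := hx.shiftNode_ne_zero hq (l := l + Pi.single i 1)
          (by rw [sum_add_single]; omega) hij.symm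
        rwa [shiftNode_add_single_of_ne t x l hij.symm] at h
      have key := eFun_swap hq (hx.shiftNode_ne_zero hq (by omega) hij) (hne hij) (hne hij.symm)
        hz hw
      have e1 : ∀ z w : ℂ, ∏ k ∈ (Finset.univ.erase j).erase i,
          (eFun q z (shiftNode t x l k) * eFun q w (shiftNode t x l k)) /
            (eFun q (shiftNode t x l j) (shiftNode t x l k) *
              eFun q (shiftNode t x l i) (shiftNode t x l k)) =
          ∏ k ∈ (Finset.univ.erase i).erase j,
          (eFun q z (shiftNode t x l k) * eFun q w (shiftNode t x l k)) /
            (eFun q (shiftNode t x l i) (shiftNode t x l k) *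
              eFun q (shiftNode t x l j) (shiftNode t x l k)) := fun z w => by
        rw [Finset.erase_right_comm]
        exact Finset.prod_congr rfl fun k _ => by ring
      have e2 : ∏ k ∈ (Finset.univ.erase i).erase j,
          (eFun q w (shiftNode t x l k) * eFun q z (shiftNode t x l k)) /
            (eFun q (shiftNode t x l i) (shiftNode t x l k) *
              eFun q (shiftNode t x l j) (shiftNode t x l k)) =
          ∏ k ∈ (Finset.univ.erase i).erase j,
          (eFun q z (shiftNode t x l k) * eFun q w (shiftNode t x l k)) /
            (eFun q (shiftNode t x l i) (shiftNode t x l k) *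
              eFun q (shiftNode t x l j) (shiftNode t x l k)) :=
        Finset.prod_congr rfl fun k _ => by ring
      rw [e1, e1, e2, ← add_mul, ← add_mul, key]
  have hsym : ∀ z w, 2 * ∑ i, ∑ j, A i j z w * φ (l + Pi.single i 1 + Pi.single j 1) =
      ∑ i, ∑ j, (A i j z w + A j i z w) * φ (l + Pi.single i 1 + Pi.single j 1) := by
    intro z w
    simp only [add_mul, Finset.sum_add_distrib, two_mul]
    congr 1
    rw [Finset.sum_comm]
    refine Finset.sum_congr rfl fun i _ => Finset.sum_congr rfl fun j _ => ?_
    rw [add_right_comm]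
  rw [hA, hA]
  apply mul_left_cancel₀ (two_ne_zero (α := ℂ))
  rw [hsym, hsym]
  simp only [hpair]

/-- The length bound keeps every point `l` met along a path within the range where genericity makes
the denominators nonzero, as commutation requires. -/
theorem interpList_perm {q t : ℂˣ} (hq : ‖(q : ℂ)‖ < 1) {n : ℕ} {x : Fin s → ℂˣ}
    (hx : IsGenericNode q t n x) {zs ws : List ℂ} (h : zs.Perm ws) (h0 : ∀ z ∈ zs, z ≠ 0)
    (φ : (Fin s → ℕ) → ℂ) (l : Fin s → ℕ) (hl : ∑ k, l k + zs.length ≤ n) :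
    interpList q t x zs φ l = interpList q t x ws φ l := by
  induction h generalizing l with
  | nil => rfl
  | cons z h ih =>
    simp only [interpList_cons, interpStep]
    refine Finset.sum_congr rfl fun i _ => ?_
    rw [ih (fun z hz => h0 z (List.mem_cons_of_mem _ hz))]
    rw [sum_add_single]
    simp only [List.length_cons] at hl
    omega
  | swap z w zs =>
    simp only [interpList_cons]
    simp only [List.length_cons] at hl
    exact interpStep_comm hq hx (by omega) (h0 _ (by simp)) (h0 _ (by simp)) _
  | trans h1 h2 ih1 ih2 =>
    rw [ih1 h0 l hl, ih2 (fun z hz => h0 z (h1.mem_iff.mpr hz)) l (h1.length_eq ▸ hl)]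

theorem lagrangeFactor_self {q : ℂˣ} {u : Fin s → ℂˣ}
    (hu : ∀ i j, i ≠ j → eFun q (u i) (u j) ≠ 0) (i : Fin s) : lagrangeFactor q u i (u i) = 1 :=
  Finset.prod_eq_one fun j hj => div_self (hu i j (Finset.ne_of_mem_erase hj).symm)

theorem lagrangeFactor_of_ne {q : ℂˣ} (hq : ‖(q : ℂ)‖ < 1) (u : Fin s → ℂˣ) {i j : Fin s}
    (hij : i ≠ j) : lagrangeFactor q u i (u j) = 0 :=
  Finset.prod_eq_zero (Finset.mem_erase.mpr ⟨hij.symm, Finset.mem_univ j⟩) (by simp [eFun_self hq])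

theorem interpStep_shiftNode {q t : ℂˣ} (hq : ‖(q : ℂ)‖ < 1) {n : ℕ} {x : Fin s → ℂˣ}
    (hx : IsGenericNode q t n x) {l : Fin s → ℕ} (hl : ∑ k, l k < n) (i : Fin s)
    (φ : (Fin s → ℕ) → ℂ) :
    interpStep q t x (shiftNode t x l i) φ l = φ (l + Pi.single i 1) := by
  rw [interpStep, Finset.sum_eq_single i]
  · rw [lagrangeFactor_self (fun i j hij => hx.shiftNode_ne_zero hq hl hij), one_mul]
  · intro j _ hj
    rw [lagrangeFactor_of_ne hq _ hj, zero_mul]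
  · simp

/-! ### Values at the interpolation nodes -/

/-- The multiset of coordinates of `x_ν`. -/
noncomputable def nodeMultiset (t : ℂˣ) (x : Fin s → ℂˣ) (ν : Fin s → ℕ) : Multiset ℂ :=
  ∑ i, ∑ a ∈ Finset.range (ν i), {((x i * t ^ a : ℂˣ) : ℂ)}

theorem coe_ofFn_nodePoint (t : ℂˣ) {n : ℕ} (x : Fin s → ℂˣ) (ν : MultiIndex s n) :
    ((List.ofFn fun k => (nodePoint t x ν k : ℂ) : List ℂ) : Multiset ℂ) =
      nodeMultiset t x ν.1 := by
  have h : Multiset.map (fun k => (nodePoint t x ν k : ℂ)) Finset.univ.val =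
      ∑ k, {(nodePoint t x ν k : ℂ)} := by
    rw [Finset.sum, ← Multiset.sum_map_singleton (Multiset.map _ _), Multiset.map_map]
    rfl
  rw [← Fin.univ_val_map, h]
  have e := Equiv.sum_comp ((finCongr ν.2.symm).trans finSigmaFinEquiv.symm)
    (fun p => ({((x p.1 * t ^ (p.2 : ℕ) : ℂˣ) : ℂ)} : Multiset ℂ))
  rw [Fintype.sum_sigma] at e
  refine e.trans (Finset.sum_congr rfl fun i _ => ?_)
  exact Fin.sum_univ_eq_sum_range (fun a => ({((x i * t ^ a : ℂˣ) : ℂ)} : Multiset ℂ)) _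

theorem nodeMultiset_add_single (t : ℂˣ) (x : Fin s → ℂˣ) (ν : Fin s → ℕ) (i : Fin s) :
    nodeMultiset t x (ν + Pi.single i 1) =
      nodeMultiset t x ν + {((x i * t ^ ν i : ℂˣ) : ℂ)} := by
  have h : ∀ j, ∑ a ∈ Finset.range ((ν + Pi.single i 1 : Fin s → ℕ) j),
      ({((x j * t ^ a : ℂˣ) : ℂ)} : Multiset ℂ) =
      ∑ a ∈ Finset.range (ν j), {((x j * t ^ a : ℂˣ) : ℂ)} +
        if j = i then {((x i * t ^ ν i : ℂˣ) : ℂ)} else 0 := by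
    intro j
    rcases eq_or_ne j i with rfl | hj
    · simp [Finset.sum_range_succ]
    · simp [hj]
  simp only [nodeMultiset, h, Finset.sum_add_distrib, Finset.sum_ite_eq', Finset.mem_univ, if_true]

/-- The list records a lattice path from `0` to `ν`: a step from `ν'` in direction `i` contributes
`x_i t^{ν'_i}`, at which the operator acts as the shift in direction `i`. Since `φ` is arbitrary,
the list can also serve as a prefix of a longer one. -/
theorem exists_list_nodeMultiset {q t : ℂˣ} (hq : ‖(q : ℂ)‖ < 1) {n : ℕ} {x : Fin s → ℂˣ}
    (hx : IsGenericNode q t n x) (ν : Fin s → ℕ) (hν : ∑ k, ν k ≤ n) :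
    ∃ zs : List ℂ, (zs : Multiset ℂ) = nodeMultiset t x ν ∧
      ∀ φ, interpList q t x zs φ 0 = φ ν := by
  induction h : ∑ k, ν k generalizing ν with
  | zero =>
    have : ν = 0 := funext fun i => by simpa using (Finset.sum_eq_zero_iff.mp h) i
    subst this
    exact ⟨[], by simp [nodeMultiset], fun φ => rfl⟩
  | succ m ih =>
    obtain ⟨i, -, hi⟩ : ∃ i ∈ Finset.univ, ν i ≠ 0 := by
      by_contra! h0
      rw [Finset.sum_eq_zero h0] at h
      omega
    obtain ⟨ν', rfl⟩ : ∃ ν' : Fin s → ℕ, ν = ν' + Pi.single i 1 := by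
      refine ⟨ν - Pi.single i 1, (tsub_add_cancel_of_le fun j => ?_).symm⟩
      rcases eq_or_ne j i with rfl | hj
      · simp; omega
      · simp [hj]
    rw [sum_add_single] at h hν
    obtain ⟨zs, hzs, hφ⟩ := ih ν' (by omega) (by omega)
    refine ⟨zs ++ [((shiftNode t x ν' i : ℂˣ) : ℂ)], ?_, fun φ => ?_⟩
    · rw [← Multiset.coe_add, hzs, nodeMultiset_add_single]
      rfl
    · rw [interpList_append, hφ]
      exact interpStep_shiftNode hq hx (by omega) i φ

theorem lagrangeFun_nodePoint_eq {q t : ℂˣ} (hq : ‖(q : ℂ)‖ < 1) {n : ℕ} {x : Fin s → ℂˣ}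
    (hx : IsGenericNode q t n x) (μ : Fin s → ℕ) (y : Fin s → ℂˣ) (ν : MultiIndex s n)
    {zs : List ℂ} (hzs : (zs : Multiset ℂ) = nodeMultiset t y ν.1) :
    lagrangeFun q t x μ (nodePoint t y ν) = interpList q t x zs (Pi.single μ 1) 0 := by
  refine interpList_perm hq hx ?_ (fun z hz => ?_) _ _ (by simp)
  · rw [← Multiset.coe_eq_coe, coe_ofFn_nodePoint, hzs]
  · obtain ⟨k, rfl⟩ := (List.mem_ofFn' _ _).mp hz
    exact Units.ne_zero _

theorem lagrangeFun_nodePoint {q t : ℂˣ} (hq : ‖(q : ℂ)‖ < 1) {n : ℕ} {x : Fin s → ℂˣ}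
    (hx : IsGenericNode q t n x) (μ : Fin s → ℕ) (ν : MultiIndex s n) :
    lagrangeFun q t x μ (nodePoint t x ν) = if μ = ν.1 then 1 else 0 := by
  obtain ⟨zs, hzs, h⟩ := exists_list_nodeMultiset hq hx ν.1 ν.2.le
  rw [lagrangeFun_nodePoint_eq hq hx μ x ν hzs, h, Pi.single_apply]
  simp only [eq_comm]

/-! ### The interpolation functions belong to the theta space -/

theorem interpStep_smul (q t : ℂˣ) (x : Fin s → ℂˣ) (z c : ℂ) (φ : (Fin s → ℕ) → ℂ) :
    interpStep q t x z (c • φ) = c • interpStep q t x z φ := by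
  funext l
  simp only [interpStep, Pi.smul_apply, smul_eq_mul, Finset.mul_sum]
  exact Finset.sum_congr rfl fun i _ => by ring

theorem interpStep_inv {q : ℂˣ} (hq : ‖(q : ℂ)‖ < 1) (t : ℂˣ) (x : Fin s → ℂˣ) {z : ℂ}
    (hz : z ≠ 0) : interpStep q t x z⁻¹ = interpStep q t x z := by
  funext φ l
  simp only [interpStep, lagrangeFactor, eFun_inv hq _ hz]

theorem lagrangeFactor_q_mul {q : ℂˣ} (hq : ‖(q : ℂ)‖ < 1) (u : Fin s → ℂˣ) (i : Fin s) {z : ℂ}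
    (hz : z ≠ 0) : lagrangeFactor q u i (q * z) =
      ((q * z ^ 2) ^ (s - 1))⁻¹ * lagrangeFactor q u i z := by
  simp only [lagrangeFactor, eFun_q_mul hq _ hz, mul_div_assoc, Finset.prod_mul_distrib,
    Finset.prod_const, inv_pow]
  simp

theorem interpStep_q_mul {q : ℂˣ} (hq : ‖(q : ℂ)‖ < 1) (t : ℂˣ) (x : Fin s → ℂˣ) {z : ℂ}
    (hz : z ≠ 0) (φ : (Fin s → ℕ) → ℂ) :
    interpStep q t x (q * z) φ = ((q * z ^ 2) ^ (s - 1))⁻¹ • interpStep q t x z φ := by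
  funext l
  simp only [interpStep, lagrangeFactor_q_mul hq _ _ hz, Pi.smul_apply, smul_eq_mul,
    Finset.mul_sum, mul_assoc]

theorem interpList_map_update {q t : ℂˣ} {x : Fin s → ℂˣ} {ι : Type*} [DecidableEq ι] {z : ι → ℂ}
    {i : ι} {w c : ℂ} (h : ∀ φ, interpStep q t x w φ = c • interpStep q t x (z i) φ)
    (φ : (Fin s → ℕ) → ℂ) {L : List ι} (hL : L.Nodup) (hi : i ∈ L) :
    interpList q t x (L.map (Function.update z i w)) φ = c • interpList q t x (L.map z) φ := by
  induction L with
  | nil => simp at hi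
  | cons j L ih =>
    rw [List.nodup_cons] at hL
    simp only [List.map_cons, interpList_cons]
    rcases eq_or_ne j i with rfl | hj
    · have e : L.map (Function.update z j w) = L.map z :=
        List.map_congr_left fun k hk => Function.update_of_ne (ne_of_mem_of_not_mem hk hL.1) _ _
      rw [e, Function.update_self, h]
    · rw [Function.update_of_ne hj, ih hL.2 ((List.mem_cons.mp hi).resolve_left hj.symm),
        interpStep_smul]

theorem lagrangeFun_update {q t : ℂˣ} {x : Fin s → ℂˣ} {n : ℕ} {z : Fin n → ℂˣ} {i : Fin n}
    {w : ℂˣ} {c : ℂ} (h : ∀ φ, interpStep q t x w φ = c • interpStep q t x (z i) φ)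
    (μ : Fin s → ℕ) :
    lagrangeFun q t x μ (Function.update z i w) = c * lagrangeFun q t x μ z := by
  have e : (fun k => (Function.update z i w k : ℂ)) =
      Function.update (fun k => (z k : ℂ)) i (w : ℂ) :=
    funext fun k => Function.apply_update (fun _ (u : ℂˣ) => (u : ℂ)) z i w k
  simp only [lagrangeFun, List.ofFn_eq_map, e]
  rw [interpList_map_update (z := fun k => (z k : ℂ)) h _ (List.nodup_finRange n)
    (List.mem_finRange i)]
  rfl

theorem differentiableAt_lagrangeFactor {q : ℂˣ} (hq : ‖(q : ℂ)‖ < 1) (u : Fin s → ℂˣ)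
    (i : Fin s) {z : ℂ} (hz : z ≠ 0) : DifferentiableAt ℂ (lagrangeFactor q u i) z :=
  DifferentiableAt.fun_finsetProd fun j _ => (differentiableAt_eFun hq (u j) hz).div_const _

theorem differentiableOn_interpList {q : ℂˣ} (hq : ‖(q : ℂ)‖ < 1) (t : ℂˣ) (x : Fin s → ℂˣ)
    {n : ℕ} (φ : (Fin s → ℕ) → ℂ) (L : List (Fin n)) (l : Fin s → ℕ) :
    DifferentiableOn ℂ (fun w : Fin n → ℂ => interpList q t x (L.map w) φ l)
      {w | ∀ i, w i ≠ 0} := by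
  induction L generalizing l with
  | nil => exact differentiableOn_const _
  | cons k L ih =>
    simp only [List.map_cons, interpList_cons, interpStep]
    refine DifferentiableOn.fun_sum fun i _ => ?_
    have hL : DifferentiableOn ℂ (fun w : Fin n → ℂ =>
        lagrangeFactor q (shiftNode t x l) i (w k)) {w | ∀ i, w i ≠ 0} := fun w hw =>
      (DifferentiableAt.fun_comp' w (differentiableAt_lagrangeFactor hq (shiftNode t x l) i (hw k))
        (by fun_prop)).differentiableWithinAt
    exact hL.fun_mul (ih _)

theorem lagrangeFun_mem_thetaSpace {q t : ℂˣ} (hq : ‖(q : ℂ)‖ < 1) {n : ℕ} {x : Fin s → ℂˣ}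
    (hx : IsGenericNode q t n x) (μ : Fin s → ℕ) :
    (lagrangeFun q t x μ : (Fin n → ℂˣ) → ℂ) ∈ thetaSpace q (s - 1) n := by
  refine ⟨⟨fun w => interpList q t x (List.ofFn w) (Pi.single μ 1) 0, ?_, fun z => rfl⟩,
    ⟨fun σ z => ?_, fun i z => ?_⟩, fun i z => ?_⟩
  · simp only [List.ofFn_eq_map]
    exact differentiableOn_interpList hq t x _ _ _
  · have hperm := Equiv.Perm.ofFn_comp_perm σ fun k => (z k : ℂ)
    refine interpList_perm hq hx hperm (fun w hw => ?_) _ _ (by simp)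
    obtain ⟨k, rfl⟩ := (List.mem_ofFn' _ _).mp hw
    exact Units.ne_zero _
  · rw [lagrangeFun_update (c := 1) (fun φ => ?_), one_mul]
    rw [Units.val_inv_eq_inv_val, interpStep_inv hq t x (z i).ne_zero, one_smul]
  · refine lagrangeFun_update (w := q * z i) (fun φ => ?_) μ
    rw [Units.val_mul, interpStep_q_mul hq t x (z i).ne_zero]

/-! ### Existence, uniqueness and change of basis -/

/-- Evaluation at the points `x_ν` as a linear map. -/
noncomputable def nodeEval (q t : ℂˣ) (n : ℕ) (x : Fin s → ℂˣ) :
    thetaSpace q (s - 1) n →ₗ[ℂ] (MultiIndex s n → ℂ) where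
  toFun f ν := (f : (Fin n → ℂˣ) → ℂ) (nodePoint t x ν)
  map_add' _ _ := rfl
  map_smul' _ _ := rfl

/-- For `t = 1` the node point repeats each `x_i` exactly `ν_i` times, so any word in the `x_i` is a
rearrangement of one, with `ν_i` the size of the fibre of `σ` over `i`. -/
theorem exists_perm_nodePoint_one {n : ℕ} (x : Fin s → ℂˣ) (σ : Fin n → Fin s) :
    ∃ (ν : MultiIndex s n) (π : Equiv.Perm (Fin n)),
      nodePoint 1 x ν = fun k => x (σ (π k)) := by
  let m : Fin s → ℕ := fun i => Fintype.card {k // σ k = i}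
  have hm : ∑ i, m i = n := by
    rw [← Fintype.card_sigma, Fintype.card_congr (Equiv.sigmaFiberEquiv σ), Fintype.card_fin]
  let e : Fin n ≃ Fin n := (finCongr hm.symm).trans (finSigmaFinEquiv.symm.trans
    ((Equiv.sigmaCongrRight fun i => (Fintype.equivFin {k // σ k = i}).symm).trans
      (Equiv.sigmaFiberEquiv σ)))
  refine ⟨⟨m, hm⟩, e, funext fun k => ?_⟩
  simp only [nodePoint, one_pow, mul_one]
  congr 1
  exact ((Fintype.equivFin {k // σ k = _}).symm _).2.symm

theorem slice_mem_lineThetaSpace {q : ℂˣ} {m n : ℕ} {f : (Fin n → ℂˣ) → ℂ}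
    (hf : f ∈ thetaSpace q m n) (z : Fin n → ℂˣ) (k : Fin n) :
    ∃ G ∈ lineThetaSpace q m, ∀ w : ℂˣ, G w = f (Function.update z k w) := by
  obtain ⟨⟨F, hF, hfF⟩, ⟨-, hinv⟩, hshift⟩ := hf
  have hG : ∀ w : ℂˣ, F (Function.update (fun j => (z j : ℂ)) k w) =
      f (Function.update z k w) := fun w => by
    rw [hfF]
    congr 1
    exact (funext fun j => Function.apply_update (fun _ (u : ℂˣ) => (u : ℂ)) z k w j).symm
  refine ⟨fun w => F (Function.update (fun j => (z j : ℂ)) k w), ⟨?_, ?_, ?_⟩, hG⟩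
  · refine hF.comp (fun w _ => ?_) fun w hw j => ?_
    · exact (hasFDerivAt_update (𝕜 := ℂ) (fun j => (z j : ℂ)) w).differentiableAt.differentiableWithinAt
    · rcases eq_or_ne j k with rfl | hj
      · simpa using hw
      · simp [hj]
  · intro w hw
    lift w to ℂˣ using isUnit_iff_ne_zero.mpr hw
    beta_reduce
    rw [← Units.val_inv_eq_inv_val, hG, hG]
    simpa using hinv k (Function.update z k w)
  · intro w hw
    lift w to ℂˣ using isUnit_iff_ne_zero.mpr hw
    beta_reduce
    rw [← Units.val_mul, hG, hG]
    simpa using hshift k (Function.update z k w)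

/-- Genericity for `t` with `a = b = 0` already separates the `x_i`. The coordinates are freed from
the set of the `x_i` one at a time, each by one-variable interpolation of degree `s - 1` at `s`
nodes. -/
theorem nodeEval_one_injective {q t : ℂˣ} (hq : ‖(q : ℂ)‖ < 1) {n : ℕ} (hs : 1 ≤ s)
    {x : Fin s → ℂˣ} (hx : IsGenericNode q t n x) : Function.Injective (nodeEval q 1 n x) := by
  rw [injective_iff_map_eq_zero]
  rintro ⟨f, hf⟩ h0
  have hS : ∀ (S : Finset (Fin n)) (z : Fin n → ℂˣ), (∀ k ∉ S, ∃ i, z k = x i) → f z = 0 := by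
    intro S
    induction S using Finset.induction_on with
    | empty =>
      intro z hz
      choose σ hσ using fun k => hz k (Finset.notMem_empty k)
      obtain ⟨ν, π, hπ⟩ := exists_perm_nodePoint_one x σ
      have h := hf.2.1.1 π z
      simp only [hσ, ← hπ] at h
      rw [← h]
      exact congrFun h0 ν
    | insert k S hk ih =>
      intro z hz
      obtain ⟨G, hG, hGf⟩ := slice_mem_lineThetaSpace hf z k
      obtain ⟨m, rfl⟩ : ∃ m, s = m + 1 := ⟨s - 1, by omega⟩
      have hzero : G (z k) = 0 := by
        refine lineThetaSpace_eq_zero hq hG x (fun i j hij => ?_) (fun i => ?_) (z k).ne_zero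
        · simpa using hx.eFun_ne_zero hq hij (a := 0) (b := 0) (k.pos)
        · rw [hGf]
          refine ih _ fun j hj => ?_
          rcases eq_or_ne j k with rfl | hjk
          · exact ⟨i, by simp⟩
          · rw [Function.update_of_ne hjk]
            exact hz j (by simp [hjk, hj])
      rw [hGf, Function.update_eq_self] at hzero
      exact hzero
  exact Subtype.ext (funext fun z => hS Finset.univ z (by simp))

/-- Injectivity at `t = 1` bounds the dimension from above by the number of multi-indices, and
surjectivity at the given `t` bounds it from below. -/
theorem nodeEval_bijective {q t : ℂˣ} (hq : ‖(q : ℂ)‖ < 1) {n : ℕ} (hs : 1 ≤ s)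
    {x : Fin s → ℂˣ} (hx : IsGenericNode q t n x) : Function.Bijective (nodeEval q t n x) := by
  have hsurj : Function.Surjective (nodeEval q t n x) := by
    intro g
    refine ⟨∑ μ : MultiIndex s n, g μ • ⟨_, lagrangeFun_mem_thetaSpace hq hx μ.1⟩, ?_⟩
    funext ν
    have h : ∀ μ : MultiIndex s n,
        nodeEval q t n x ⟨_, lagrangeFun_mem_thetaSpace hq hx μ.1⟩ ν = if μ = ν then 1 else 0 :=
      fun μ => (lagrangeFun_nodePoint hq hx μ.1 ν).trans (by simp only [Subtype.ext_iff])
    simp only [map_sum, map_smul, Finset.sum_apply, Pi.smul_apply, h]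
    simp
  have hinj := nodeEval_one_injective hq hs hx
  have : FiniteDimensional ℂ (thetaSpace q (s - 1) n) := FiniteDimensional.of_injective _ hinj
  have hrank := le_antisymm (LinearMap.finrank_le_finrank_of_injective hinj)
    (LinearMap.finrank_le_finrank_of_surjective hsurj)
  exact ⟨(LinearMap.injective_iff_surjective_of_finrank_eq_finrank hrank).mpr hsurj, hsurj⟩

theorem existsUnique_isLagrangeBasis {q t : ℂˣ} (hq : ‖(q : ℂ)‖ < 1) {n : ℕ} (hs : 1 ≤ s)
    {x : Fin s → ℂˣ} (hx : IsGenericNode q t n x) :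
    ∃! E : Module.Basis (MultiIndex s n) ℂ (thetaSpace q (s - 1) n), IsLagrangeBasis q t x E := by
  have hb := nodeEval_bijective hq hs hx
  let e := LinearEquiv.ofBijective _ hb
  have hE : IsLagrangeBasis q t x (Module.Basis.ofEquivFun e) := fun l μ => by
    have h : nodeEval q t n x (Module.Basis.ofEquivFun e l) = Pi.single l 1 := by
      rw [Module.Basis.coe_ofEquivFun]
      exact e.apply_symm_apply _
    have := congrFun h μ
    rw [Pi.single_apply] at this
    simp only [eq_comm (a := l)]
    exact this
  refine ⟨_, hE, fun E' hE' => Module.Basis.eq_of_apply_eq fun l => hb.1 (funext fun μ => ?_)⟩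
  exact (hE' l μ).trans (hE l μ).symm

theorem isLagrangeBasis_apply {q t : ℂˣ} (hq : ‖(q : ℂ)‖ < 1) {n : ℕ} (hs : 1 ≤ s)
    {x : Fin s → ℂˣ} (hx : IsGenericNode q t n x)
    {E : Module.Basis (MultiIndex s n) ℂ (thetaSpace q (s - 1) n)}
    (hE : IsLagrangeBasis q t x E) (μ : MultiIndex s n) :
    (E μ : (Fin n → ℂˣ) → ℂ) = lagrangeFun q t x μ.1 := by
  have h : E μ = ⟨_, lagrangeFun_mem_thetaSpace hq hx μ.1⟩ :=
    (nodeEval_bijective hq hs hx).1 (funext fun ν => (hE μ ν).trans <| by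
      simp only [Subtype.ext_iff]
      exact (lagrangeFun_nodePoint hq hx μ.1 ν).symm)
  exact congrArg Subtype.val h

theorem transitionMatrix_eq_mul {q t : ℂˣ} (hq : ‖(q : ℂ)‖ < 1) {n : ℕ} (hs : 1 ≤ s)
    {x : Fin s → ℂˣ} (hx : IsGenericNode q t n x)
    {E E' : Module.Basis (MultiIndex s n) ℂ (thetaSpace q (s - 1) n)}
    (hE : IsLagrangeBasis q t x E) (y : Fin s → ℂˣ) :
    transitionMatrix q t E' y = transitionMatrix q t E' x * transitionMatrix q t E y := by
  ext μ ν
  have h : E' μ = ∑ l, transitionMatrix q t E' x μ l • E l := by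
    refine (nodeEval_bijective hq hs hx).1 (funext fun κ => ?_)
    have hl : ∀ l, nodeEval q t n x (E l) κ = if l = κ then 1 else 0 := fun l => hE l κ
    simp only [map_sum, map_smul, Finset.sum_apply, Pi.smul_apply, hl]
    simp [transitionMatrix, nodeEval]
  rw [Matrix.mul_apply]
  have := congrFun (congrArg (nodeEval q t n y) h) ν
  simpa [map_sum, nodeEval, transitionMatrix] using this

/-! ### The determinant when one coordinate changes -/

/-- Lattice paths only increase coordinates, so none leads from `l` to `μ`. -/
theorem interpList_single_eq_zero (q t : ℂˣ) (x : Fin s → ℂˣ) (zs : List ℂ) {μ l : Fin s → ℕ}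
    {j : Fin s} (h : μ j < l j) : interpList q t x zs (Pi.single μ 1) l = 0 := by
  induction zs generalizing l with
  | nil =>
    refine Pi.single_eq_of_ne (fun hl => ?_) _
    rw [hl] at h
    exact h.false
  | cons z zs ih =>
    rw [interpList_cons]
    refine Finset.sum_eq_zero fun i _ => ?_
    rw [ih (h.trans_le (by simp)), mul_zero]

/-- Only the coordinate `p` is still short of its target, so the straight path in direction `p` is
the only one that contributes. -/
theorem interpList_single_update (q t : ℂˣ) (x : Fin s → ℂˣ) (f : ℕ → ℂ) (p : Fin s)
    (ν : Fin s → ℕ) (c a : ℕ) (h : a + c = ν p) :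
    interpList q t x ((List.range' a c).map f) (Pi.single ν 1) (Function.update ν p a) =
      ∏ b ∈ Finset.Ico a (a + c),
        lagrangeFactor q (shiftNode t x (Function.update ν p b)) p (f b) := by
  induction c generalizing a with
  | zero =>
    rw [add_zero] at h
    subst h
    simp [interpList]
  | succ c ih =>
    have e : Function.update ν p a + Pi.single p 1 = Function.update ν p (a + 1) := by
      funext j
      rcases eq_or_ne j p with rfl | hj
      · simp
      · simp [hj]
    rw [List.range'_succ, List.map_cons, interpList_cons, interpStep, Finset.sum_eq_single p]
    · rw [e, ih (a + 1) (by omega), Finset.prod_eq_prod_Ico_succ_bot (b := a + (c + 1)) (by omega),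
        add_assoc a 1 c, add_comm 1 c]
    · intro i _ hi
      rw [interpList_single_eq_zero q t x _ (j := i), mul_zero]
      simp [hi]
    · simp

theorem nodeMultiset_update (t : ℂˣ) (x : Fin s → ℂˣ) (p : Fin s) (w : ℂˣ) (ν : Fin s → ℕ) :
    nodeMultiset t (Function.update x p w) ν = nodeMultiset t x (Function.update ν p 0) +
      ∑ a ∈ Finset.range (ν p), {((w * t ^ a : ℂˣ) : ℂ)} := by
  unfold nodeMultiset
  rw [← Finset.add_sum_erase _ _ (Finset.mem_univ p),
    ← Finset.add_sum_erase Finset.univ _ (Finset.mem_univ p)]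
  simp only [Function.update_self, Finset.range_zero, Finset.sum_empty, zero_add]
  rw [add_comm]
  congr 1
  refine Finset.sum_congr rfl fun i hi => ?_
  rw [Function.update_of_ne (Finset.ne_of_mem_erase hi),
    Function.update_of_ne (Finset.ne_of_mem_erase hi)]

theorem sum_update_zero_le (ν : Fin s → ℕ) (p : Fin s) :
    ∑ k, Function.update ν p 0 k ≤ ∑ k, ν k :=
  Finset.sum_le_sum fun k _ => by
    rcases eq_or_ne k p with rfl | h
    · simp
    · simp [h]

/-- By symmetry the unchanged coordinates can be consumed first; they move the start of the path
from `0` to `ν` with its entry at `p` set to `0`. -/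
theorem lagrangeFun_nodePoint_update {q t : ℂˣ} (hq : ‖(q : ℂ)‖ < 1) {n : ℕ} {x : Fin s → ℂˣ}
    (hx : IsGenericNode q t n x) (p : Fin s) (w : ℂˣ) (μ : Fin s → ℕ) (ν : MultiIndex s n) :
    lagrangeFun q t x μ (nodePoint t (Function.update x p w) ν) =
      interpList q t x ((List.range' 0 (ν.1 p)).map fun a => ((w * t ^ a : ℂˣ) : ℂ))
        (Pi.single μ 1) (Function.update ν.1 p 0) := by
  obtain ⟨zs, hzs, h⟩ := exists_list_nodeMultiset hq hx (Function.update ν.1 p 0)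
    ((sum_update_zero_le ν.1 p).trans ν.2.le)
  rw [lagrangeFun_nodePoint_eq hq hx μ _ ν (zs := zs ++ (List.range' 0 (ν.1 p)).map
    fun a => ((w * t ^ a : ℂˣ) : ℂ)) ?_, interpList_append, h]
  rw [← Multiset.coe_add, hzs, nodeMultiset_update, ← List.range_eq_range', ← Multiset.map_coe,
    Multiset.coe_range]
  congr 1
  rw [Finset.sum, Finset.range_val, ← Multiset.sum_map_singleton (Multiset.map _ _),
    Multiset.map_map]
  rfl

theorem MultiIndex.eq_of_le {n : ℕ} {μ ν : MultiIndex s n} (h : ∀ j, ν.1 j ≤ μ.1 j) : μ = ν := by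
  refine Subtype.ext (funext fun j => ?_)
  have := (Finset.sum_eq_sum_iff_of_le fun j _ => h j).mp (ν.2.trans μ.2.symm)
  exact (this j (Finset.mem_univ j)).symm

/-- A permutation contributing to the determinant has `b (σ i) ≤ b i` for all `i`. Both sides have
the same sum, so equality holds throughout and `σ = 1`. -/
theorem Matrix.det_eq_prod_diag_of_forall {ι : Type*} [Fintype ι] [DecidableEq ι]
    (M : Matrix ι ι ℂ) (b : ι → ℕ) (h : ∀ i j, M i j ≠ 0 → b i ≤ b j)
    (h' : ∀ i j, M i j ≠ 0 → b i = b j → i = j) : M.det = ∏ i, M i i := by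
  rw [Matrix.det_apply, Finset.sum_eq_single 1]
  · simp
  · intro σ _ hσ
    by_contra hne
    have hM : ∀ i, M (σ i) i ≠ 0 := fun i hi => hne <| by
      have h0 : ∏ i, M (σ i) i = 0 := Finset.prod_eq_zero (Finset.mem_univ i) hi
      rw [h0, smul_zero]
    have hb := (Finset.sum_eq_sum_iff_of_le fun i _ => h _ _ (hM i)).mp (Equiv.sum_comp σ b)
    exact hσ (Equiv.ext fun i => h' _ _ (hM i) (hb i (Finset.mem_univ i)))
  · simp

theorem det_lagrangeFun_update {q t : ℂˣ} (hq : ‖(q : ℂ)‖ < 1) {n : ℕ} {x : Fin s → ℂˣ}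
    (hx : IsGenericNode q t n x) (p : Fin s) (w : ℂˣ) :
    (Matrix.of fun μ ν : MultiIndex s n =>
      lagrangeFun q t x μ.1 (nodePoint t (Function.update x p w) ν)).det =
    ∏ ν : MultiIndex s n, ∏ a ∈ Finset.range (ν.1 p), ∏ j ∈ Finset.univ.erase p,
      eFun q ((w * t ^ a : ℂˣ) : ℂ) (x j * t ^ ν.1 j) /
        eFun q ((x p * t ^ a : ℂˣ) : ℂ) (x j * t ^ ν.1 j) := by
  have hle : ∀ μ ν : MultiIndex s n,
      lagrangeFun q t x μ.1 (nodePoint t (Function.update x p w) ν) ≠ 0 →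
      ∀ j, j ≠ p → ν.1 j ≤ μ.1 j := by
    intro μ ν h j hj
    by_contra! hlt
    rw [lagrangeFun_nodePoint_update hq hx] at h
    exact h (interpList_single_eq_zero q t x _ (j := j) (by simpa [hj] using hlt))
  -- A nonzero entry forces `ν_j ≤ μ_j` for `j ≠ p`; as both totals are `n`, also `μ_p ≤ ν_p`, with
  -- equality only on the diagonal.
  rw [Matrix.det_eq_prod_diag_of_forall _ fun μ : MultiIndex s n => μ.1 p]
  · refine Finset.prod_congr rfl fun ν _ => ?_
    rw [Matrix.of_apply, lagrangeFun_nodePoint_update hq hx,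
      interpList_single_update q t x (fun a => ((w * t ^ a : ℂˣ) : ℂ)) p ν.1 (ν.1 p) 0 (zero_add _),
      zero_add, ← Finset.range_eq_Ico]
    refine Finset.prod_congr rfl fun a _ => Finset.prod_congr rfl fun j hj => ?_
    simp only [shiftNode, Function.update_self, Function.update_of_ne (Finset.ne_of_mem_erase hj)]
  · intro μ ν h
    have h1 := Finset.add_sum_erase Finset.univ μ.1 (Finset.mem_univ p)
    have h2 := Finset.add_sum_erase Finset.univ ν.1 (Finset.mem_univ p)
    have h3 : ∑ j ∈ Finset.univ.erase p, ν.1 j ≤ ∑ j ∈ Finset.univ.erase p, μ.1 j :=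
      Finset.sum_le_sum fun j hj => hle μ ν h j (Finset.ne_of_mem_erase hj)
    have := μ.2
    have := ν.2
    omega
  · intro μ ν h hp
    refine MultiIndex.eq_of_le fun j => ?_
    rcases eq_or_ne j p with rfl | hj
    · exact hp.ge
    · exact hle μ ν h j hj

/-! ### Counting multiplicities -/

theorem card_piAntidiag_eq_choose {ι : Type*} [DecidableEq ι] (S : Finset ι) (k : ℕ) :
    (Finset.piAntidiag S k).card = (S.card + k - 1).choose k := by
  rw [← Finset.card_finsuppAntidiag_nat_eq_choose]
  simp [Finset.finsuppAntidiag]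

/-- The number of `ν` with `ν_p > a` and `ν_j = b`. -/
theorem card_multiIndex_filter {n : ℕ} {p j : Fin s} (hpj : j ≠ p) {a b : ℕ} (hab : a + b < n) :
    (Finset.univ.filter fun ν : MultiIndex s n => a < ν.1 p ∧ ν.1 j = b).card =
      (s + (n - (a + b)) - 3).choose (n - (a + b) - 1) := by
  have hs : 2 ≤ s := by
    have := p.2; have := j.2; have := Fin.val_ne_of_ne hpj
    omega
  have hc : (Finset.univ.erase j).card = s - 1 := by simp
  have e1 : s + (n - (a + b)) - 3 = (Finset.univ.erase j).card + (n - (a + b) - 1) - 1 := by omega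
  rw [e1, ← card_piAntidiag_eq_choose]
  -- Subtracting the least admissible multi-index `c` leaves `n - (a + b) - 1` units to distribute
  -- freely over the `s - 1` indices other than `j`.
  obtain ⟨c, hcp, hcj, hci, hcs⟩ : ∃ c : Fin s → ℕ, c p = a + 1 ∧ c j = b ∧
      (∀ i, i ≠ p → i ≠ j → c i = 0) ∧ ∑ i, c i = a + 1 + b := by
    refine ⟨Pi.single p (a + 1) + Pi.single j b, ?_, ?_, fun i h1 h2 => ?_, ?_⟩
    · simp [hpj.symm]
    · simp [hpj]
    · simp [h1, h2]
    · simp [Finset.sum_add_distrib]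
  have hle : ∀ ν : Fin s → ℕ, a < ν p → ν j = b → c ≤ ν := by
    intro ν h1 h2 i
    by_cases hip : i = p
    · rw [hip, hcp]
      exact h1
    · by_cases hij : i = j
      · rw [hij, hcj, h2]
      · rw [hci i hip hij]
        exact Nat.zero_le _
  have herase : ∀ κ : Fin s → ℕ, κ j = 0 → ∑ i ∈ Finset.univ.erase j, κ i = ∑ i, κ i := by
    intro κ h
    rw [← Finset.add_sum_erase _ _ (Finset.mem_univ j), h, zero_add]
  have hmem : ∀ κ ∈ Finset.piAntidiag (Finset.univ.erase j) (n - (a + b) - 1),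
      κ j = 0 ∧ ∑ i, (κ + c) i = n := by
    intro κ hκ
    rw [Finset.mem_piAntidiag] at hκ
    have h0 : κ j = 0 := by
      by_contra h
      simpa using hκ.2 j h
    have h1 : ∑ i, κ i = n - (a + b) - 1 := (herase κ h0).symm.trans hκ.1
    refine ⟨h0, ?_⟩
    simp only [Pi.add_apply, Finset.sum_add_distrib, hcs, h1]
    omega
  refine Finset.card_bij' (fun ν _ => ν.1 - c) (fun κ hκ => ⟨κ + c, (hmem κ hκ).2⟩) ?_ ?_ ?_ ?_
  · intro ν hν
    simp only [Finset.mem_filter, Finset.mem_univ, true_and] at hν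
    have h0 : (ν.1 - c) j = 0 := by simp [hν.2, hcj]
    have hsum : ∑ i, (ν.1 - c) i + ∑ i, c i = n := by
      rw [← Finset.sum_add_distrib]
      exact (Finset.sum_congr rfl fun i _ => Nat.sub_add_cancel (hle ν.1 hν.1 hν.2 i)).trans ν.2
    rw [Finset.mem_piAntidiag]
    refine ⟨(herase _ h0).trans (by omega), fun i hi => ?_⟩
    simp only [Finset.mem_erase, Finset.mem_univ, and_true]
    rintro rfl
    exact hi h0
  · intro κ hκ
    simp only [Finset.mem_filter, Finset.mem_univ, true_and, Pi.add_apply, hcp, hcj,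
      (hmem κ hκ).1, zero_add, and_true]
    omega
  · intro ν hν
    simp only [Finset.mem_filter, Finset.mem_univ, true_and] at hν
    exact Subtype.ext (tsub_add_cancel_of_le (hle ν.1 hν.1 hν.2))
  · intro κ _
    exact add_tsub_cancel_right κ c

/-- Factors are grouped by `m = a + b`, and `k = n - m`: the multiplicity of `g a b` depends on the
pair only through `a + b`. -/
theorem prod_multiIndex_eq {n : ℕ} {p j : Fin s} (hpj : j ≠ p) (g : ℕ → ℕ → ℂ) :
    ∏ ν : MultiIndex s n, ∏ a ∈ Finset.range (ν.1 p), g a (ν.1 j) =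
      ∏ k ∈ Finset.Icc 1 n, (∏ r ∈ Finset.range (n - k + 1), g r (n - k - r)) ^
        Nat.choose (s + k - 3) (k - 1) := by
  have h1 : ∀ ν : MultiIndex s n, ∏ a ∈ Finset.range (ν.1 p), g a (ν.1 j) =
      ∏ m ∈ Finset.range n, ∏ ab ∈ Finset.HasAntidiagonal.antidiagonal m,
        if ab.1 < ν.1 p ∧ ν.1 j = ab.2 then g ab.1 ab.2 else 1 := by
    intro ν
    have hν : ν.1 j + ν.1 p ≤ n := (add_le_sum_of_ne hpj).trans ν.2.le
    rw [Finset.prod_sigma', ← Finset.prod_filter]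
    refine Finset.prod_nbij' (fun a => ⟨a + ν.1 j, (a, ν.1 j)⟩) (fun x => x.2.1) ?_ ?_ ?_ ?_ ?_
    · intro a ha
      simp only [Finset.mem_range] at ha
      simp [ha]
      omega
    · intro x hx
      simp only [Finset.mem_filter] at hx
      simpa using hx.2.1
    · intro a _
      rfl
    · rintro ⟨m, a, b⟩ hx
      simp only [Finset.mem_filter, Finset.mem_sigma, Finset.HasAntidiagonal.mem_antidiagonal] at hx
      obtain ⟨⟨-, rfl⟩, -, rfl⟩ := hx
      rfl
    · intro a _
      rfl
  simp only [h1]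
  rw [Finset.prod_comm]
  have h2 : ∀ m ∈ Finset.range n, ∏ ν : MultiIndex s n, ∏ ab ∈ Finset.HasAntidiagonal.antidiagonal m,
      (if ab.1 < ν.1 p ∧ ν.1 j = ab.2 then g ab.1 ab.2 else 1) =
      (∏ r ∈ Finset.range (m + 1), g r (m - r)) ^ Nat.choose (s + (n - m) - 3) (n - m - 1) := by
    intro m hm
    rw [Finset.prod_comm, ← Finset.Nat.prod_antidiagonal_eq_prod_range_succ, ← Finset.prod_pow]
    refine Finset.prod_congr rfl fun ab hab => ?_
    rw [Finset.HasAntidiagonal.mem_antidiagonal] at hab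
    subst hab
    rw [← Finset.prod_filter, Finset.prod_const, card_multiIndex_filter hpj (by simpa using hm)]
  rw [Finset.prod_congr rfl h2]
  refine Finset.prod_nbij' (fun m => n - m) (fun k => n - k) ?_ ?_ ?_ ?_ ?_
  · intro m hm
    simp only [Finset.mem_range, Finset.mem_Icc] at hm ⊢
    omega
  · intro m hm
    simp only [Finset.mem_range, Finset.mem_Icc] at hm ⊢
    omega
  · intro m hm
    simp only [Finset.mem_range] at hm
    omega
  · intro m hm
    simp only [Finset.mem_Icc] at hm
    omega
  · intro m hm
    simp only [Finset.mem_range] at hm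
    rw [show n - (n - m) = m by omega]

/-! ### The product formula for one changed coordinate -/

/-- The product evaluating the determinant of an arbitrary basis of `H_{s-1,n}` at the points
`y_ν`, up to a constant. -/
noncomputable def detProd (q t : ℂˣ) (n : ℕ) (y : Fin s → ℂˣ) : ℂ :=
  ∏ k ∈ Finset.Icc 1 n, (∏ r ∈ Finset.range (n - k + 1), ∏ i : Fin s, ∏ j ∈ Finset.Ioi i,
    eFun q ((y i * t ^ r : ℂˣ) : ℂ) (y j * t ^ (n - k - r))) ^ Nat.choose (s + k - 3) (k - 1)

theorem detProd_ne_zero {q t : ℂˣ} (hq : ‖(q : ℂ)‖ < 1) {n : ℕ} {x : Fin s → ℂˣ}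
    (hx : IsGenericNode q t n x) : detProd q t n x ≠ 0 := by
  simp only [detProd, Finset.prod_ne_zero_iff]
  intro k hk
  refine pow_ne_zero _ ?_
  simp only [Finset.prod_ne_zero_iff]
  intro r hr i _ j hj
  simp only [Finset.mem_Icc, Finset.mem_range, Finset.mem_Ioi] at hk hr hj
  exact hx.eFun_ne_zero hq hj.ne (by omega)

theorem prod_prod_Ioi_eq {R : Fin s → Fin s → ℂ} (hR : ∀ i j, i ≠ j → R i j = R j i) (p : Fin s)
    (h1 : ∀ i j, i ≠ p → j ≠ p → R i j = 1) :
    ∏ i, ∏ j ∈ Finset.Ioi i, R i j = ∏ j ∈ Finset.univ.erase p, R p j := by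
  rw [← Finset.mul_prod_erase _ _ (Finset.mem_univ p)]
  have ha : ∏ j ∈ Finset.Ioi p, R p j =
      ∏ j ∈ Finset.univ.erase p, if p < j then R p j else 1 := by
    rw [← Finset.prod_filter]
    refine Finset.prod_congr (Finset.ext fun j => ?_) fun _ _ => rfl
    simp only [Finset.mem_Ioi, Finset.mem_filter, Finset.mem_erase, Finset.mem_univ, and_true]
    exact ⟨fun h => ⟨h.ne', h⟩, fun h => h.2⟩
  rw [ha, ← Finset.prod_mul_distrib]
  refine Finset.prod_congr rfl fun i hi => ?_
  have hip := Finset.ne_of_mem_erase hi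
  rcases lt_or_gt_of_ne hip with h | h
  · rw [if_neg h.not_gt, one_mul, Finset.prod_eq_single p]
    · exact hR i p hip
    · intro j _ hj
      exact h1 i j hip hj
    · simp [h]
  · rw [if_pos h, Finset.prod_eq_one, mul_one]
    intro j hj
    exact h1 i j hip (h.trans (Finset.mem_Ioi.mp hj)).ne'

/-- Reverse the product by `r ↦ m - r` and use antisymmetry of `e`. The sign is independent of `a`
and `b`, so it cancels in ratios, which are therefore symmetric in the pair of indices. -/
theorem prod_eFun_swap {q : ℂˣ} (hq : ‖(q : ℂ)‖ < 1) (t : ℂˣ) (a b : ℂˣ) (m : ℕ) :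
    ∏ r ∈ Finset.range (m + 1), eFun q ((a * t ^ r : ℂˣ) : ℂ) (b * t ^ (m - r)) =
      (-1) ^ (m + 1) *
        ∏ r ∈ Finset.range (m + 1), eFun q ((b * t ^ r : ℂˣ) : ℂ) (a * t ^ (m - r)) := by
  rw [← Finset.prod_range_reflect]
  have h : ∀ r ∈ Finset.range (m + 1),
      eFun q ((a * t ^ (m + 1 - 1 - r) : ℂˣ) : ℂ) (b * t ^ (m - (m + 1 - 1 - r))) =
        -1 * eFun q ((b * t ^ r : ℂˣ) : ℂ) (a * t ^ (m - r)) := by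
    intro r hr
    rw [Finset.mem_range] at hr
    rw [eFun_antisymm hq, show m - (m + 1 - 1 - r) = r by omega, Nat.add_sub_cancel, neg_one_mul]
  rw [Finset.prod_congr rfl h, Finset.prod_mul_distrib, Finset.prod_const, Finset.card_range]

theorem prod_eFun_ratio_update {q t : ℂˣ} (hq : ‖(q : ℂ)‖ < 1) {n : ℕ} {x : Fin s → ℂˣ}
    (hx : IsGenericNode q t n x) (p : Fin s) (w : ℂˣ) {m : ℕ} (hm : m < n) :
    ∏ j ∈ Finset.univ.erase p, ∏ r ∈ Finset.range (m + 1),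
        (eFun q ((w * t ^ r : ℂˣ) : ℂ) (x j * t ^ (m - r)) /
          eFun q ((x p * t ^ r : ℂˣ) : ℂ) (x j * t ^ (m - r))) =
      (∏ r ∈ Finset.range (m + 1), ∏ i, ∏ j ∈ Finset.Ioi i,
        eFun q ((Function.update x p w i * t ^ r : ℂˣ) : ℂ)
          (Function.update x p w j * t ^ (m - r))) /
      ∏ r ∈ Finset.range (m + 1), ∏ i, ∏ j ∈ Finset.Ioi i,
        eFun q ((x i * t ^ r : ℂˣ) : ℂ) (x j * t ^ (m - r)) := by
  let h : (Fin s → ℂˣ) → Fin s → Fin s → ℂ := fun y i j =>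
    ∏ r ∈ Finset.range (m + 1), eFun q ((y i * t ^ r : ℂˣ) : ℂ) (y j * t ^ (m - r))
  have hcomm : ∀ y : Fin s → ℂˣ, ∏ r ∈ Finset.range (m + 1), ∏ i, ∏ j ∈ Finset.Ioi i,
      eFun q ((y i * t ^ r : ℂˣ) : ℂ) (y j * t ^ (m - r)) = ∏ i, ∏ j ∈ Finset.Ioi i, h y i j := by
    intro y
    rw [Finset.prod_comm]
    exact Finset.prod_congr rfl fun i _ => Finset.prod_comm
  have hne : ∀ i j, i ≠ j → h x i j ≠ 0 := fun i j hij =>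
    Finset.prod_ne_zero_iff.mpr fun r hr => hx.eFun_ne_zero hq hij (by
      rw [Finset.mem_range] at hr
      omega)
  let y := Function.update x p w
  have hR : ∀ i j, h y i j / h x i j = h y j i / h x j i := fun i j => by
    simp only [h]
    rw [prod_eFun_swap hq t (y i) (y j), prod_eFun_swap hq t (x i) (x j),
      mul_div_mul_left _ _ (pow_ne_zero _ (by norm_num))]
  let R : Fin s → Fin s → ℂ := fun i j => if i = j then 1 else h y i j / h x i j
  have hprod := prod_prod_Ioi_eq (R := R) (fun i j hij => by simp [R, hij, hij.symm, hR i j]) p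
    fun i j hi hj => by
      by_cases hij : i = j
      · simp [R, hij]
      · have e : h y i j = h x i j := by simp [h, y, hi, hj]
        simp only [R, hij, if_false, e]
        exact div_self (hne i j hij)
  rw [hcomm, hcomm, ← Finset.prod_div_distrib]
  simp only [← Finset.prod_div_distrib]
  refine Eq.trans ?_ (hprod.symm.trans ?_)
  · refine Finset.prod_congr rfl fun j hj => ?_
    have hj := Finset.ne_of_mem_erase hj
    simp [R, hj.symm, h, y, hj, Finset.prod_div_distrib]
  · refine Finset.prod_congr rfl fun i _ => Finset.prod_congr rfl fun j hj => ?_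
    have hij := (Finset.mem_Ioi.mp hj).ne
    simp [R, hij, y]

theorem det_lagrangeFun_update_eq_div {q t : ℂˣ} (hq : ‖(q : ℂ)‖ < 1) {n : ℕ} {x : Fin s → ℂˣ}
    (hx : IsGenericNode q t n x) (p : Fin s) (w : ℂˣ) :
    (Matrix.of fun μ ν : MultiIndex s n =>
      lagrangeFun q t x μ.1 (nodePoint t (Function.update x p w) ν)).det =
    detProd q t n (Function.update x p w) / detProd q t n x := by
  rw [det_lagrangeFun_update hq hx]
  have h1 : ∀ ν : MultiIndex s n, ∏ a ∈ Finset.range (ν.1 p), ∏ j ∈ Finset.univ.erase p,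
      eFun q ((w * t ^ a : ℂˣ) : ℂ) (x j * t ^ ν.1 j) /
        eFun q ((x p * t ^ a : ℂˣ) : ℂ) (x j * t ^ ν.1 j) =
      ∏ j ∈ Finset.univ.erase p, ∏ a ∈ Finset.range (ν.1 p),
      eFun q ((w * t ^ a : ℂˣ) : ℂ) (x j * t ^ ν.1 j) /
        eFun q ((x p * t ^ a : ℂˣ) : ℂ) (x j * t ^ ν.1 j) := fun ν => Finset.prod_comm
  simp only [h1]
  rw [Finset.prod_comm]
  have h2 : ∀ j ∈ Finset.univ.erase p, ∏ ν : MultiIndex s n, ∏ a ∈ Finset.range (ν.1 p),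
      eFun q ((w * t ^ a : ℂˣ) : ℂ) (x j * t ^ ν.1 j) /
        eFun q ((x p * t ^ a : ℂˣ) : ℂ) (x j * t ^ ν.1 j) = _ := fun j hj =>
    prod_multiIndex_eq (Finset.ne_of_mem_erase hj) fun a b =>
      eFun q ((w * t ^ a : ℂˣ) : ℂ) (x j * t ^ b) / eFun q ((x p * t ^ a : ℂˣ) : ℂ) (x j * t ^ b)
  rw [Finset.prod_congr rfl h2, Finset.prod_comm, detProd, detProd, ← Finset.prod_div_distrib]
  refine Finset.prod_congr rfl fun k hk => ?_
  rw [Finset.mem_Icc] at hk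
  rw [Finset.prod_pow, ← div_pow, prod_eFun_ratio_update hq hx p w (by omega)]

theorem det_transitionMatrix_update {q t : ℂˣ} (hq : ‖(q : ℂ)‖ < 1) {n : ℕ} (hs : 1 ≤ s)
    {x : Fin s → ℂˣ} (hx : IsGenericNode q t n x)
    (E : Module.Basis (MultiIndex s n) ℂ (thetaSpace q (s - 1) n)) (p : Fin s) (w : ℂˣ) :
    (transitionMatrix q t E (Function.update x p w)).det * detProd q t n x =
      (transitionMatrix q t E x).det * detProd q t n (Function.update x p w) := by
  obtain ⟨E', hE', -⟩ := existsUnique_isLagrangeBasis hq hs hx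
  rw [transitionMatrix_eq_mul hq hs hx hE', Matrix.det_mul]
  have h : transitionMatrix q t E' (Function.update x p w) = Matrix.of fun μ ν : MultiIndex s n =>
      lagrangeFun q t x μ.1 (nodePoint t (Function.update x p w) ν) := by
    ext μ ν
    simp only [transitionMatrix, Matrix.of_apply, isLagrangeBasis_apply hq hs hx hE']
  rw [h, det_lagrangeFun_update_eq_div hq hx, mul_assoc, div_mul_cancel₀ _ (detProd_ne_zero hq hx)]

/-! ### From one coordinate to all, and removal of genericity -/

theorem det_transitionMatrix_of_piecewise {q t : ℂˣ} (hq : ‖(q : ℂ)‖ < 1) {n : ℕ} (hs : 1 ≤ s)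
    {x y : Fin s → ℂˣ} (hxy : ∀ S : Finset (Fin s), IsGenericNode q t n (S.piecewise y x))
    (E : Module.Basis (MultiIndex s n) ℂ (thetaSpace q (s - 1) n)) :
    (transitionMatrix q t E y).det * detProd q t n x =
      (transitionMatrix q t E x).det * detProd q t n y := by
  have h : ∀ S : Finset (Fin s),
      (transitionMatrix q t E (S.piecewise y x)).det * detProd q t n x =
        (transitionMatrix q t E x).det * detProd q t n (S.piecewise y x) := by
    intro S
    induction S using Finset.induction_on with
    | empty => simp
    | insert p S hp ih =>
      rw [Finset.piecewise_insert]
      have h1 := det_transitionMatrix_update hq hs (hxy S) E p (y p)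
      -- The intermediate point is generic, so its nonzero product cancels when the new exchange is
      -- combined with the induction hypothesis.
      apply mul_right_cancel₀ (detProd_ne_zero hq (hxy S))
      linear_combination detProd q t n x * h1 +
        detProd q t n (Function.update (S.piecewise y x) p (y p)) * ih
  simpa using h Finset.univ

/-- The real exponential as a nonzero complex number. -/
noncomputable def expUnit (u : ℝ) : ℂˣ := Units.mk0 (Real.exp u : ℂ) (by simp)

theorem coe_expUnit (u : ℝ) : (expUnit u : ℂ) = Real.exp u := rfl

theorem expUnit_zero : expUnit 0 = 1 := Units.ext (by simp [coe_expUnit])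

theorem expUnit_mul (u v : ℝ) : expUnit u * expUnit v = expUnit (u + v) :=
  Units.ext (by simp [coe_expUnit, Complex.exp_add])

theorem expUnit_inv (u : ℝ) : (expUnit u)⁻¹ = expUnit (-u) :=
  inv_eq_of_mul_eq_one_right (by rw [expUnit_mul, add_neg_cancel, expUnit_zero])

theorem countable_setOf_mul_expUnit (q A : ℂˣ) {α : ℝ} (hα : α ≠ 0) :
    {u : ℝ | ∃ l : ℤ, A * expUnit (u * α) = q ^ l}.Countable := by
  rw [show {u : ℝ | ∃ l : ℤ, A * expUnit (u * α) = q ^ l} =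
    ⋃ l : ℤ, {u : ℝ | A * expUnit (u * α) = q ^ l} by ext; simp]
  refine Set.countable_iUnion fun l => Set.Subsingleton.countable fun u hu v hv => ?_
  have h : expUnit (u * α) = expUnit (v * α) := mul_left_cancel (a := A) (hu.trans hv.symm)
  have h2 := congrArg (fun z : ℂˣ => (z : ℂ)) h
  simp only [coe_expUnit] at h2
  exact mul_right_cancel₀ hα (Real.exp_injective (Complex.ofReal_injective h2))

theorem countable_setOf_eFun_eq_zero {q : ℂˣ} (hq : ‖(q : ℂ)‖ < 1) (A B : ℂˣ) {α β : ℝ}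
    (h1 : α + β ≠ 0) (h2 : α - β ≠ 0) :
    {u : ℝ | eFun q ((A * expUnit (u * α) : ℂˣ) : ℂ) (B * expUnit (u * β)) = 0}.Countable := by
  refine ((countable_setOf_mul_expUnit q (A * B) h1).union
    (countable_setOf_mul_expUnit q (A * B⁻¹) h2)).mono fun u hu => ?_
  obtain ⟨l, hl⟩ := eFun_eq_zero hq _ _ hu
  rw [← Units.val_inv_eq_inv_val, ← Units.val_mul, ← Units.val_mul, ← Units.val_zpow_eq_zpow_val,
    Units.val_inj, Units.val_inj] at hl
  rcases hl with hl | hl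
  · refine .inl ⟨l, ?_⟩
    rw [← hl, mul_add, ← expUnit_mul, mul_mul_mul_comm]
  · refine .inr ⟨l, ?_⟩
    rw [← hl, mul_sub, sub_eq_add_neg, ← expUnit_mul, ← expUnit_inv, mul_inv, mul_mul_mul_comm]

/-- The perturbed point `(y_i e^{(i + 1) u})_i`. -/
noncomputable def perturb (y : Fin s → ℂˣ) (u : ℝ) : Fin s → ℂˣ :=
  fun i => y i * expUnit (u * ((i : ℕ) + 1))

theorem perturb_zero (y : Fin s → ℂˣ) : perturb y 0 = y := by
  funext i
  simp [perturb, expUnit_zero]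

/-- The perturbation exponents are positive and distinct on `S` and zero off `S`. For `i < j` not
both outside `S`, their sum and difference are thus nonzero, so each vanishing condition excludes
countably many `u`; pairs outside `S` are covered by genericity of `x`. -/
theorem countable_setOf_not_isGenericNode {q t : ℂˣ} (hq : ‖(q : ℂ)‖ < 1) {n : ℕ}
    {x : Fin s → ℂˣ} (hx : IsGenericNode q t n x) (y : Fin s → ℂˣ) (S : Finset (Fin s)) :
    {u : ℝ | ¬ IsGenericNode q t n (S.piecewise (perturb y u) x)}.Countable := by
  let α : Fin s → ℝ := fun i => if i ∈ S then (i : ℕ) + 1 else 0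
  have hpw : ∀ u i, S.piecewise (perturb y u) x i = S.piecewise y x i * expUnit (u * α i) := by
    intro u i
    by_cases hi : i ∈ S
    · simp [hi, perturb, α]
    · simp [hi, α, expUnit_zero]
  have hsub : {u : ℝ | ¬ IsGenericNode q t n (S.piecewise (perturb y u) x)} ⊆
      ⋃ i, ⋃ j, ⋃ _ : i < j ∧ (i ∈ S ∨ j ∈ S), ⋃ a : ℕ, ⋃ b : ℕ,
        {u : ℝ | eFun q ((S.piecewise y x i * t ^ a * expUnit (u * α i) : ℂˣ) : ℂ)
          (S.piecewise y x j * t ^ b * expUnit (u * α j)) = 0} := by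
    intro u hu
    simp only [Set.mem_ofPred_eq, IsGenericNode, not_forall, not_not] at hu
    obtain ⟨i, j, hij, a, b, hab, h⟩ := hu
    by_cases hS : i ∈ S ∨ j ∈ S
    · simp only [Set.mem_iUnion, Set.mem_ofPred_eq]
      refine ⟨i, j, ⟨hij, hS⟩, a, b, ?_⟩
      rwa [eSymbol_eq_eFun, hpw, hpw, mul_right_comm, mul_right_comm (S.piecewise y x j)] at h
    · rw [not_or] at hS
      rw [Finset.piecewise_eq_of_notMem _ _ _ hS.1, Finset.piecewise_eq_of_notMem _ _ _ hS.2] at h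
      exact absurd h (hx i j hij a b hab)
  refine Set.Countable.mono hsub (Set.countable_iUnion fun i => Set.countable_iUnion fun j =>
    Set.countable_iUnion fun hij => Set.countable_iUnion fun a => Set.countable_iUnion fun b =>
    countable_setOf_eFun_eq_zero hq _ _ ?_ ?_)
  · have hi : 0 ≤ α i := by simp only [α]; split_ifs <;> positivity
    have hj : 0 ≤ α j := by simp only [α]; split_ifs <;> positivity
    rcases hij.2 with h | h
    · have : 0 < α i := by simp only [α, h, if_true]; positivity
      positivity
    · have : 0 < α j := by simp only [α, h, if_true]; positivity
      positivity
  · have hlt : ((i : ℕ) : ℝ) < (j : ℕ) := by exact_mod_cast hij.1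
    have hi0 : (0 : ℝ) ≤ (i : ℕ) := by positivity
    by_cases h1 : i ∈ S <;> by_cases h2 : j ∈ S <;> simp only [α, h1, h2, if_true, if_false]
    · intro h; linarith
    · intro h; linarith
    · intro h; linarith
    · exact absurd hij.2 (by simp [h1, h2])

theorem continuous_eFun {q : ℂˣ} (hq : ‖(q : ℂ)‖ < 1) {a b : ℝ → ℂˣ}
    (ha : Continuous fun u => (a u : ℂ)) (hb : Continuous fun u => (b u : ℂ)) :
    Continuous fun u => eFun q (a u) (b u) := by
  have ha0 : ∀ u, (a u : ℂ) ≠ 0 := fun u => (a u).ne_zero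
  have hb0 : ∀ u, (b u : ℂ) ≠ 0 := fun u => (b u).ne_zero
  have hθ : ContinuousOn (thetaFun q) {0}ᶜ := fun z hz =>
    (differentiableAt_thetaFun hq hz).continuousAt.continuousWithinAt
  have hbi : Continuous fun u => (b u : ℂ)⁻¹ := hb.inv₀ hb0
  refine ((ha.inv₀ ha0).mul (hθ.comp_continuous (ha.mul hb) fun u => ?_)).mul
    (hθ.comp_continuous (ha.mul hbi) fun u => ?_)
  · exact mul_ne_zero (ha0 u) (hb0 u)
  · exact mul_ne_zero (ha0 u) (inv_ne_zero (hb0 u))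

theorem continuous_perturb (y : Fin s → ℂˣ) (t : ℂˣ) (i : Fin s) (a : ℕ) :
    Continuous fun u => ((perturb y u i * t ^ a : ℂˣ) : ℂ) := by
  simp only [perturb, Units.val_mul, coe_expUnit]
  fun_prop

theorem continuous_detProd_perturb {q : ℂˣ} (hq : ‖(q : ℂ)‖ < 1) (t : ℂˣ) (n : ℕ)
    (y : Fin s → ℂˣ) : Continuous fun u => detProd q t n (perturb y u) :=
  continuous_finsetProd _ fun _ _ => (continuous_finsetProd _ fun _ _ =>
    continuous_finsetProd _ fun _ _ => continuous_finsetProd _ fun _ _ =>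
      continuous_eFun hq (continuous_perturb y t _ _) (continuous_perturb y t _ _)).pow _

theorem continuous_det_transitionMatrix_perturb (q t : ℂˣ) {n : ℕ}
    (E : Module.Basis (MultiIndex s n) ℂ (thetaSpace q (s - 1) n)) (y : Fin s → ℂˣ) :
    Continuous fun u => (transitionMatrix q t E (perturb y u)).det := by
  refine Continuous.matrix_det (continuous_matrix fun μ ν => ?_)
  obtain ⟨⟨F, hF, hfF⟩, -⟩ := (E μ).2
  simp only [transitionMatrix, Matrix.of_apply, hfF]
  refine hF.continuousOn.comp_continuous (continuous_pi fun k => continuous_perturb y t _ _)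
    fun u k => Units.ne_zero _

theorem det_transitionMatrix {q t : ℂˣ} (hq : ‖(q : ℂ)‖ < 1) {n : ℕ} (hs : 1 ≤ s)
    {x : Fin s → ℂˣ} (hx : IsGenericNode q t n x)
    (E : Module.Basis (MultiIndex s n) ℂ (thetaSpace q (s - 1) n)) (y : Fin s → ℂˣ) :
    (transitionMatrix q t E y).det * detProd q t n x =
      (transitionMatrix q t E x).det * detProd q t n y := by
  have hB := Set.countable_iUnion fun S : Finset (Fin s) =>
    countable_setOf_not_isGenericNode hq hx y S
  -- Off a countable set of parameters all intermediate points are generic. That complement is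
  -- dense, so the identity extends by continuity to the parameter `0`, where the perturbed point is
  -- `y` itself.
  have h := Continuous.ext_on (hB.dense_compl ℝ)
    ((continuous_det_transitionMatrix_perturb q t E y).mul_const (detProd q t n x))
    ((continuous_detProd_perturb hq t n y).const_mul (transitionMatrix q t E x).det)
    fun u hu => by
      refine det_transitionMatrix_of_piecewise hq hs (fun S => ?_) E
      by_contra hS
      exact hu (Set.mem_iUnion.mpr ⟨S, hS⟩)
  simpa only [perturb_zero] using congrFun h 0

theorem det_transitionMatrix_eq_div {q t : ℂˣ} (hq : ‖(q : ℂ)‖ < 1) {n : ℕ} (hs : 1 ≤ s)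
    {x : Fin s → ℂˣ} (hx : IsGenericNode q t n x)
    {E : Module.Basis (MultiIndex s n) ℂ (thetaSpace q (s - 1) n)}
    (hE : IsLagrangeBasis q t x E) (y : Fin s → ℂˣ) :
    (transitionMatrix q t E y).det = detProd q t n y / detProd q t n x := by
  have h1 : transitionMatrix q t E x = 1 := by
    ext μ ν
    rw [transitionMatrix, Matrix.of_apply, hE μ ν, Matrix.one_apply]
  rw [eq_div_iff (detProd_ne_zero hq hx), det_transitionMatrix hq hs hx E y, h1, Matrix.det_one,
    one_mul]

/-! ### The two forms of the determinant formula -/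

theorem detProd_div_detProd (q t : ℂˣ) (n : ℕ) (x y : Fin s → ℂˣ) :
    detProd q t n y / detProd q t n x =
      ∏ k ∈ Finset.Icc 1 n,
        (∏ r ∈ Finset.range (n - k + 1), ∏ i : Fin s, ∏ j ∈ Finset.Ioi i,
          eSymbol q (y i * t ^ r) (y j * t ^ (n - k - r)) /
            eSymbol q (x i * t ^ r) (x j * t ^ (n - k - r))) ^ Nat.choose (s + k - 3) (k - 1) := by
  simp only [detProd, eSymbol_eq_eFun, Finset.prod_div_distrib, div_pow]

theorem eSymbol_mul_pow (q t a b : ℂˣ) {n k r : ℕ} (hk : k ≤ n) (hr : r ≤ n - k) :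
    eSymbol q (a * t ^ r) (b * t ^ (n - k - r)) =
      (a : ℂ)⁻¹ * ((t : ℂ) ^ r)⁻¹ * theta q (t ^ (n - k) * a * b) *
        theta q (t ^ (2 * (r : ℤ) - ((n : ℤ) - (k : ℤ))) * a * b⁻¹) := by
  obtain ⟨c, hc⟩ := Nat.exists_eq_add_of_le hr
  have e1 : a * t ^ r * (b * t ^ (n - k - r)) = t ^ (n - k) * a * b := by
    rw [hc, Nat.add_sub_cancel_left, pow_add]
    simp only [mul_comm, mul_left_comm, mul_assoc]
  have e2 : a * t ^ r * (b * t ^ (n - k - r))⁻¹ =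
      t ^ (2 * (r : ℤ) - ((n : ℤ) - (k : ℤ))) * a * b⁻¹ := by
    rw [hc, Nat.add_sub_cancel_left, show 2 * (r : ℤ) - ((n : ℤ) - (k : ℤ)) = r - c by omega,
      zpow_sub, zpow_natCast, zpow_natCast, mul_inv]
    simp only [mul_comm, mul_left_comm, mul_assoc]
  rw [eSymbol, e1, e2, Units.val_mul, Units.val_pow_eq_pow_val, mul_inv]

theorem eSymbol_div_eSymbol (q t : ℂˣ) (a b c d : ℂˣ) {n k r : ℕ} (hk : k ≤ n)
    (hr : r ≤ n - k) :
    eSymbol q (a * t ^ r) (b * t ^ (n - k - r)) / eSymbol q (c * t ^ r) (d * t ^ (n - k - r)) =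
      ((c : ℂ) * theta q (t ^ (2 * (r : ℤ) - ((n : ℤ) - (k : ℤ))) * a * b⁻¹) *
          theta q (t ^ (n - k) * a * b)) /
        ((a : ℂ) * theta q (t ^ (2 * (r : ℤ) - ((n : ℤ) - (k : ℤ))) * c * d⁻¹) *
          theta q (t ^ (n - k) * c * d)) := by
  rw [eSymbol_mul_pow q t a b hk hr, eSymbol_mul_pow q t c d hk hr]
  have ha := a.ne_zero
  have hc := c.ne_zero
  have ht := t.ne_zero
  field_simp

theorem mainTheorem5 (q t : ℂˣ) (hq : ‖(q : ℂ)‖ < 1) (s n : ℕ) (hs : 1 ≤ s)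
    (x : Fin s → ℂˣ) (hx : IsGenericNode q t n x) :
    (∃! E : Module.Basis (MultiIndex s n) ℂ (thetaSpace q (s - 1) n), IsLagrangeBasis q t x E) ∧
    ∀ E : Module.Basis (MultiIndex s n) ℂ (thetaSpace q (s - 1) n), IsLagrangeBasis q t x E →
      ∀ y : Fin s → ℂˣ,
        (transitionMatrix q t E y).det =
          ∏ k ∈ Finset.Icc 1 n,
            (∏ r ∈ Finset.range (n - k + 1), ∏ i : Fin s, ∏ j ∈ Finset.Ioi i,
              eSymbol q (y i * t ^ r) (y j * t ^ (n - k - r)) /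
                eSymbol q (x i * t ^ r) (x j * t ^ (n - k - r))) ^
              Nat.choose (s + k - 3) (k - 1) ∧
        (transitionMatrix q t E y).det =
          ∏ k ∈ Finset.Icc 1 n,
            (∏ r ∈ Finset.range (n - k + 1), ∏ i : Fin s, ∏ j ∈ Finset.Ioi i,
              ((x i : ℂ) * theta q (t ^ (2 * (r : ℤ) - ((n : ℤ) - (k : ℤ))) * y i * (y j)⁻¹) *
                  theta q (t ^ (n - k) * y i * y j)) /
                ((y i : ℂ) * theta q (t ^ (2 * (r : ℤ) - ((n : ℤ) - (k : ℤ))) * x i * (x j)⁻¹) *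
                  theta q (t ^ (n - k) * x i * x j))) ^
              Nat.choose (s + k - 3) (k - 1) := by
  refine ⟨existsUnique_isLagrangeBasis hq hs hx, fun E hE y => ?_⟩
  have h := (det_transitionMatrix_eq_div hq hs hx hE y).trans (detProd_div_detProd q t n x y)
  refine ⟨h, h.trans (Finset.prod_congr rfl fun k hk => ?_)⟩
  congr 1
  refine Finset.prod_congr rfl fun r hr => Finset.prod_congr rfl fun i _ =>
    Finset.prod_congr rfl fun j _ => ?_
  rw [Finset.mem_Icc] at hk
  rw [Finset.mem_range] at hr
  exact eSymbol_div_eSymbol q t _ _ _ _ hk.2 (by omega)
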